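/- Let $\mathbb U(2^n)$ be the unitary group on $n$ qubits. For a random unitary $V$ with law $\mathcal D$ on $\mathbb U(2^n)$ put $\Psi_{\mathcal D}(A)=\mathbb E_{V\sim\mathcal D}[V^{\otimes 2}A\,V^{\dagger\otimes 2}]$. The law $\mathcal D$ is an *$\epsilon$-approximate unitary 2-design* if $\|\Psi_{\mathrm{Haar}}-\Psi_{\mathcal D}\|_{1\to1}\le\epsilon$, where $\|\Psi\|_{1\to 1}=\max_\rho\|\Psi(\rho)\|_1$, the maximum being over all density matrices $\rho$ and $\|\cdot\|_1$ being the trace norm. Let $\mathcal P_n=\{I/\sqrt2,X/\sqrt2,Y/\sqrt2,Z/\sqrt2\}^{\otimes n}$, and for $s\in\mathcal P_n$ let $|s|$ be the number of qubits on which $s$ is not proportional to $I$. For a layered circuit $U=U_LU_{L-1}\cdots U_1$ on $n$ qubits, the observable $O=|0^n\rangle\langle0^n|$, the input state $\rho=|0^n\rangle\langle 0^n|$, a Pauli path $\gamma=(s_0,\dots,s_L)\in\mathcal P_n^{L+1}$ and an integer $k\ge0$, put $$\Phi_\gamma(U)=\mathrm{Tr}[Os_L]\prod_{j=1}^L\mathrm{Tr}[U_j^\dagger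 s_jU_js_{j-1}],\qquad f_U(O)=\mathrm{Tr}[OU\rho U^\dagger]=|\langle 0^n|U|0^n\rangle|^2,$$ $$\tilde f_U^{(k)}(O)=\sum_{\gamma:\ |s_i|\le k\ \forall i\neq0}\Phi_\gamma(U)\,\mathrm{Tr}[s_0\rho],$$ the last being the output of low-weight Pauli propagation. A random circuit $U$ has *orthogonal Pauli paths* if $\mathbb E_U[\Phi_\gamma(U)\Phi_{\gamma'}(U)]=0$ for all $\gamma\ne\gamma'$. **Theorem.** Let $U=U^{(A)}U^{(B)}$ be a random circuit on $n$ qubits with orthogonal Pauli paths, where $U^{(A)}$ and $U^{(B)}$ are independent random layered circuits (the layers of $U^{(B)}$ act first on the state), each having a unitary whose law is an $\epsilon$-approximate unitary 2-design. 1. There is an absolute constant $C>0$ such that, for all $n$, $k$, $\epsilon$, all numbers of layers and all such $U$, $$\mathrm{Var}_U\,\tilde f_U^{(k)}(|0^n\rangle\langle0^n|)\ \le\ C\,n^{4k}2^{-5n}+C\,\epsilon\,n^k2^{-n}.$$ 2. Low-weight Pauli propagation does not violate XQUATH when $\epsilon\le 1/(2^nn^k)$. Precisely, fix $k$ and let $(U_n)_n$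 be a sequence of such random circuits, $U_n$ on $n$ qubits, with parameters $\epsilon_n$ satisfying $\epsilon_n\le 1/(2^nn^k)$ for all large $n$. Then, as $n\to\infty$, the score $$\mathrm{XQ}_n=\mathbb E\big[(f_{U_n}(|0^n\rangle\langle0^n|)-2^{-n})^2\big]-\mathbb E\big[(f_{U_n}(|0^n\rangle\langle0^n|)-\tilde f^{(k)}_{U_n}(|0^n\rangle\langle0^n|))^2\big]$$ is $o(2^{-3n})$; in particular it is not $\Omega(2^{-3n})$, the score that a violation of XQUATH requires. -/

import Mathlib

open MeasureTheory ProbabilityTheory Filter Asymptotics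
open scoped Kronecker ComplexOrder

noncomputable section

namespace PauliProp

/-! ### Qubits, unitaries and the Haar measure -/

/-- Complex matrices on `n` qubits; the computational basis is indexed by bit strings. -/
abbrev QMat (n : ℕ) : Type := Matrix (Fin n → Fin 2) (Fin n → Fin 2) ℂ

/-- The unitary group `U(2^n)`. -/
abbrev QUnitary (n : ℕ) : Type := Matrix.unitaryGroup (Fin n → Fin 2) ℂ

instance instMeasurableSpaceQUnitary (n : ℕ) : MeasurableSpace (QUnitary n) := borel _

instance instBorelSpaceQUnitary (n : ℕ) : BorelSpace (QUnitary n) := ⟨rfl⟩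

instance instCompactSpaceQUnitary (n : ℕ) : CompactSpace (QUnitary n) := by
  refine (isCompact_iff_compactSpace
    (s := (Matrix.unitaryGroup (Fin n → Fin 2) ℂ : Set (QMat n)))).mp ?_
  refine IsCompact.of_isClosed_subset
    (isCompact_univ_pi (fun _ => isCompact_univ_pi (fun _ => isCompact_closedBall (0 : ℂ) 1)))
    ?_ ?_
  · have h : ((Matrix.unitaryGroup (Fin n → Fin 2) ℂ : Set (QMat n)))
        = {A : QMat n | A * star A = 1} := by
      ext A
      exact Matrix.mem_unitaryGroup_iff
    rw [h]
    exact isClosed_eq (by fun_prop) continuous_const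
  · intro A hA i _ j _
    simpa using entry_norm_bound_of_unitary hA i j

/-- The Haar probability measure on `U(2^n)`. -/
def haarUnitary (n : ℕ) : Measure (QUnitary n) := Measure.haarMeasure ⊤

/-! ### Approximate unitary 2-designs -/

/-- The trace norm `‖A‖₁ = Tr √(A† A)`, the sum of the singular values of `A`. -/
def traceNorm {m : Type*} [Fintype m] [DecidableEq m] (A : Matrix m m ℂ) : ℝ :=
  ∑ i, Real.sqrt ((Matrix.isHermitian_conjTranspose_mul_self A).eigenvalues i)

/-- Density matrices (quantum states). -/
def IsState {m : Type*} [Fintype m] (ρ : Matrix m m ℂ) : Prop :=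
  ρ.PosSemidef ∧ ρ.trace = 1

/-- The induced `1 → 1` norm `max_ρ ‖Ψ(ρ)‖₁` of a superoperator, over all quantum states `ρ`
(taken in the extended reals, so that the supremum always exists). -/
def oneToOneNorm {m : Type*} [Fintype m] [DecidableEq m]
    (Ψ : Matrix m m ℂ → Matrix m m ℂ) : EReal :=
  ⨆ (ρ : Matrix m m ℂ) (_ : IsState ρ), ((traceNorm (Ψ ρ) : ℝ) : EReal)

/-- The second moment channel `Ψ_D(A) = E_{U ∼ D} [U^{⊗2} A U^{†⊗2}]`; the expectation of a matrix
is taken entrywise. -/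
def secondMoment {n : ℕ} (D : Measure (QUnitary n))
    (A : Matrix ((Fin n → Fin 2) × (Fin n → Fin 2)) ((Fin n → Fin 2) × (Fin n → Fin 2)) ℂ) :
    Matrix ((Fin n → Fin 2) × (Fin n → Fin 2)) ((Fin n → Fin 2) × (Fin n → Fin 2)) ℂ :=
  Matrix.of fun i j =>
    ∫ U : QUnitary n,
      (((U : QMat n) ⊗ₖ (U : QMat n)) * A * ((U : QMat n) ⊗ₖ (U : QMat n)).conjTranspose) i j ∂D

/-- `D` is an `ε`-approximate unitary 2-design: `‖Ψ_Haar - Ψ_D‖_{1 → 1} ≤ ε`. -/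
def IsApproxTwoDesign {n : ℕ} (D : Measure (QUnitary n)) (ε : ℝ) : Prop :=
  oneToOneNorm (fun A => secondMoment (haarUnitary n) A - secondMoment D A) ≤ (ε : EReal)

/-! ### Pauli operators -/

/-- The Pauli matrices `I, X, Y, Z`, labelled by `0, 1, 2, 3`. -/
def pauli : Fin 4 → Matrix (Fin 2) (Fin 2) ℂ :=
  ![1, !![0, 1; 1, 0], !![0, -Complex.I; Complex.I, 0], !![1, 0; 0, -1]]

/-- Labels of the Pauli strings in `{I, X, Y, Z}^{⊗n}`. -/
abbrev PauliLabel (n : ℕ) : Type := Fin n → Fin 4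

/-- The normalized Pauli operator `⨂ᵢ (P_{s i} / √2)`. -/
def normPauli {n : ℕ} (s : PauliLabel n) : QMat n :=
  Matrix.of fun x y => ∏ i, (((Real.sqrt 2)⁻¹ : ℝ) : ℂ) * pauli (s i) (x i) (y i)

/-- The weight of a Pauli string: the number of qubits on which it is not the identity. -/
def weight {n : ℕ} (s : PauliLabel n) : ℕ := (Finset.univ.filter fun i => s i ≠ 0).card

/-- `Tr[A B]` as a real number (it is real for Hermitian `A` and `B`, the only case used). -/
def trR {n : ℕ} (A B : QMat n) : ℝ := (A * B).trace.re

/-- The projector `|0^n⟩⟨0^n|`. -/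
def zeroProj (n : ℕ) : QMat n := Matrix.single 0 0 1

/-! ### Layered circuits and Pauli paths

A circuit with `L` layers is a tuple `u : Fin L → QUnitary n`; the entry `u j` is the layer
`U_{j+1}`, so that layer `U_1 = u 0` acts first on the state. A random circuit is given by
its law, a measure on `Fin L → QUnitary n`. -/

/-- The unitary `U = U_L ⋯ U_2 U_1` of a circuit. -/
def circuitUnitary {n L : ℕ} (u : Fin L → QUnitary n) : QUnitary n :=
  (List.ofFn u).reverse.prod

/-- `f_U(O) = Tr[O U ρ U†]`. -/
def expval {n L : ℕ} (O ρ : QMat n) (u : Fin L → QUnitary n) : ℝ :=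
  trR O ((circuitUnitary u : QMat n) * ρ * (circuitUnitary u : QMat n).conjTranspose)

/-- A Pauli path `γ = (s_0, …, s_L)`. -/
abbrev PauliPath (n L : ℕ) : Type := Fin (L + 1) → PauliLabel n

/-- The Fourier coefficient
`Φ_γ(U) = Tr[O s_L] ∏_{j=1}^L Tr[U_j† s_j U_j s_{j-1}]` of a Pauli path. -/
def fourierCoeff {n L : ℕ} (O : QMat n) (u : Fin L → QUnitary n) (γ : PauliPath n L) : ℝ :=
  trR O (normPauli (γ (Fin.last L))) *
    ∏ j : Fin L,
      trR ((u j : QMat n).conjTranspose * normPauli (γ j.succ) * (u j : QMat n))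
        (normPauli (γ j.castSucc))

/-- The random circuit with law `μ` has orthogonal Pauli paths for the observable `O`:
`E_U Φ_γ(U) Φ_{γ'}(U) = 0` whenever `γ ≠ γ'`. -/
def HasOrthogonalPauliPaths {n L : ℕ} (O : QMat n) (μ : Measure (Fin L → QUnitary n)) : Prop :=
  ∀ γ γ' : PauliPath n L, γ ≠ γ' → ∫ u, fourierCoeff O u γ * fourierCoeff O u γ' ∂μ = 0

/-- The paths `S_k` kept by low-weight Pauli propagation: `|s_i| ≤ k` for all `i ≠ 0`. -/
def lowWeightPaths (n L k : ℕ) : Finset (PauliPath n L) :=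
  Finset.univ.filter fun γ => ∀ i, i ≠ 0 → weight (γ i) ≤ k

/-- The low-weight Pauli propagation estimator
`f̃_U^{(k)}(O) = ∑_{γ ∈ S_k} Φ_γ(U) Tr[s_0 ρ]`. -/
def lowWeightEstimator {n L : ℕ} (k : ℕ) (O ρ : QMat n) (u : Fin L → QUnitary n) : ℝ :=
  ∑ γ ∈ lowWeightPaths n L k, fourierCoeff O u γ * trR (normPauli (γ 0)) ρ

/-- The law of the random circuit `U^{(A)} U^{(B)}`, where `U^{(A)} ∼ μA` and `U^{(B)} ∼ μB` are
independent random layered circuits: the layers of `U^{(B)}` come first, those of `U^{(A)}` last. -/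
def composeLaw {n LA LB : ℕ} (μA : Measure (Fin LA → QUnitary n))
    (μB : Measure (Fin LB → QUnitary n)) : Measure (Fin (LB + LA) → QUnitary n) :=
  (μA.prod μB).map fun p => Fin.append p.2 p.1

/-- The XQUATH score of an estimator `q` for the output probability
`f_U(|0^n⟩⟨0^n|) = |⟨0^n|U|0^n⟩|²`:
`XQ = E_U (f_U - 2^{-n})² - E_U (f_U - q(U))²`. -/
def XQ {n L : ℕ} (μ : Measure (Fin L → QUnitary n)) (q : (Fin L → QUnitary n) → ℝ) : ℝ :=
  (∫ u, (expval (zeroProj n) (zeroProj n) u - 1 / 2 ^ n) ^ 2 ∂μ) -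
    ∫ u, (expval (zeroProj n) (zeroProj n) u - q u) ^ 2 ∂μ

end PauliProp

end

namespace PauliProp

/-! ### Tensor products of one-qubit matrices -/

/-! Orthogonality turns the statement into a sum of second moments. The all-identity path
contributes the constant `2⁻ⁿ`, every other path has mean zero, and distinct contributions are
uncorrelated. Hence the variance of the estimator is the sum of the second moments of the retained
nonzero paths (`variance_lowWeightEstimator`), and the XQUATH score is this same sum, since the
paths discarded by the truncation cancel between its two terms (`XQ_lowWeightEstimator`).

These second moments need not be computed path by path. Fix the label `r` at the output and the
label `s` at the cut between the two circuits. Adding the missing paths of any weight only increases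
the sum of second moments, and by orthogonality that enlarged sum is the second moment of the full
sum over the group. Completeness of the Pauli basis collapses the full sum to `Tr[O r] Tr[A† r A s]
Tr[B† s B ρ]` (`sum_pathTerm_cut`), and independence factorizes its second moment. Unitary
conjugation fixes the identity and preserves tracelessness, so apart from `(0, 0)` only pairs of
non-identity strings survive.

Each factor is small: `Tr[O r]²` is at most `2⁻ⁿ`, a Haar moment is at most `2/4ⁿ` times `Tr B²`,
and passing to an approximate design costs `ε` for the first circuit (`moment_normPauli_le`) and
`ε/2ⁿ` for the second (`moment_zeroProj_le`). There are at most `e³ nᵏ` labels on each side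
(`card_lowLabels_le`).

The two claims use these estimates differently. For the first, Parseval over `s` saves a power of
the label count in the terms with `ε`. At `ε = 1/(2ⁿ nᵏ)` that bound is only of order `4⁻ⁿ`, too
weak for the second claim, which keeps the product of the two moment bounds and gets `O(n^{2k}
2^{-4n})`. -/

/-- The tensor product `⨂ᵢ A i` of one-qubit matrices. -/
def tensorMat {n : ℕ} (A : Fin n → Matrix (Fin 2) (Fin 2) ℂ) : QMat n :=
  Matrix.of fun x y => ∏ i, A i (x i) (y i)

lemma tensorMat_mul {n : ℕ} (A B : Fin n → Matrix (Fin 2) (Fin 2) ℂ) :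
    tensorMat A * tensorMat B = tensorMat fun i => A i * B i := by
  ext x y
  simp only [tensorMat, Matrix.mul_apply, Matrix.of_apply, Finset.prod_univ_sum,
    Fintype.piFinset_univ, Finset.prod_mul_distrib]

lemma trace_tensorMat {n : ℕ} (A : Fin n → Matrix (Fin 2) (Fin 2) ℂ) :
    (tensorMat A).trace = ∏ i, (A i).trace := by
  simp only [tensorMat, Matrix.trace, Matrix.diag, Matrix.of_apply, Finset.prod_univ_sum,
    Fintype.piFinset_univ]

lemma tensorMat_one {n : ℕ} : tensorMat (fun _ : Fin n => 1) = 1 := by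
  ext x y
  by_cases h : x = y
  · subst h
    simp [tensorMat, Matrix.one_apply_eq]
  · obtain ⟨i, hi⟩ := Function.ne_iff.mp h
    simp only [tensorMat, Matrix.of_apply, Matrix.one_apply_ne h]
    exact Finset.prod_eq_zero (Finset.mem_univ i) (Matrix.one_apply_ne hi)

lemma tensorMat_smul {n : ℕ} (c : Fin n → ℂ) (A : Fin n → Matrix (Fin 2) (Fin 2) ℂ) :
    (tensorMat fun i => c i • A i) = (∏ i, c i) • tensorMat A := by
  ext x y
  simp [tensorMat, Finset.prod_mul_distrib]

lemma tensorMat_conjTranspose {n : ℕ} (A : Fin n → Matrix (Fin 2) (Fin 2) ℂ) :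
    (tensorMat A).conjTranspose = tensorMat fun i => (A i).conjTranspose := by
  ext x y
  simp [tensorMat, Matrix.conjTranspose_apply]

/-! ### One-qubit Pauli matrices -/

/-- The sign with which two one-qubit Pauli matrices commute. -/
def commSign₁ (a b : Fin 4) : ℝ := if a = 0 ∨ b = 0 ∨ a = b then 1 else -1

lemma pauli_conjTranspose (a : Fin 4) : (pauli a).conjTranspose = pauli a := by
  fin_cases a <;> ext i j <;> fin_cases i <;> fin_cases j <;> simp [pauli]

lemma pauli_mul_self (a : Fin 4) : pauli a * pauli a = 1 := by
  fin_cases a <;> ext i j <;> fin_cases i <;> fin_cases j <;>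
    simp [pauli, Matrix.mul_apply, Fin.sum_univ_two]

lemma pauli_mul_comm (a b : Fin 4) :
    pauli a * pauli b = ((commSign₁ a b : ℝ) : ℂ) • (pauli b * pauli a) := by
  fin_cases a <;> fin_cases b <;> ext i j <;> fin_cases i <;> fin_cases j <;>
    simp [pauli, commSign₁, Matrix.mul_apply, Fin.sum_univ_two]

lemma trace_pauli {a : Fin 4} (ha : a ≠ 0) : (pauli a).trace = 0 := by
  fin_cases a <;> simp_all [pauli, Matrix.trace, Fin.sum_univ_two]

lemma sum_commSign₁ {a : Fin 4} (ha : a ≠ 0) : ∑ b, commSign₁ a b = 0 := by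
  fin_cases a <;> simp_all [commSign₁, Fin.sum_univ_four]

lemma sum_pauli_mul_pauli (x y x' y' : Fin 2) :
    ∑ a, pauli a y x * pauli a x' y' = if x = x' ∧ y = y' then 2 else 0 := by
  fin_cases x <;> fin_cases y <;> fin_cases x' <;> fin_cases y' <;>
    simp [pauli, Fin.sum_univ_four] <;> norm_num

/-! ### Normalized Pauli strings -/

lemma inv_sqrt_two_sq : (((Real.sqrt 2)⁻¹ : ℝ) : ℂ) * (((Real.sqrt 2)⁻¹ : ℝ) : ℂ) = 1 / 2 := by
  rw [← Complex.ofReal_mul, ← mul_inv, Real.mul_self_sqrt (by norm_num)]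
  norm_num

lemma inv_sqrt_two_pow_sq (n : ℕ) :
    (((Real.sqrt 2)⁻¹ : ℝ) : ℂ) ^ n * (((Real.sqrt 2)⁻¹ : ℝ) : ℂ) ^ n = 1 / 2 ^ n := by
  rw [← mul_pow, inv_sqrt_two_sq, one_div_pow]

lemma normPauli_eq {n : ℕ} (s : PauliLabel n) :
    normPauli s = (((Real.sqrt 2)⁻¹ : ℝ) : ℂ) ^ n • tensorMat fun i => pauli (s i) := by
  ext x y
  simp [normPauli, tensorMat, Finset.prod_mul_distrib]

lemma normPauli_isHermitian {n : ℕ} (s : PauliLabel n) : (normPauli s).IsHermitian := by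
  simp only [Matrix.IsHermitian, normPauli_eq, Matrix.conjTranspose_smul, tensorMat_conjTranspose,
    pauli_conjTranspose]
  congr 1
  simp only [star_pow, Complex.star_def, Complex.conj_ofReal]

lemma normPauli_mul {n : ℕ} (s t : PauliLabel n) :
    normPauli s * normPauli t =
      ((1 : ℂ) / 2 ^ n) • tensorMat fun i => pauli (s i) * pauli (t i) := by
  rw [normPauli_eq, normPauli_eq, smul_mul_smul_comm, inv_sqrt_two_pow_sq, tensorMat_mul]

lemma normPauli_mul_self {n : ℕ} (s : PauliLabel n) :
    normPauli s * normPauli s = ((1 : ℂ) / 2 ^ n) • 1 := by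
  simp only [normPauli_mul, pauli_mul_self, tensorMat_one]

/-- The sign with which two Pauli strings commute. -/
def commSign {n : ℕ} (s t : PauliLabel n) : ℝ := ∏ i, commSign₁ (s i) (t i)

lemma commSign_eq_one_or {n : ℕ} (s t : PauliLabel n) : commSign s t = 1 ∨ commSign s t = -1 := by
  unfold commSign
  refine Finset.prod_induction _ (fun x : ℝ => x = 1 ∨ x = -1) ?_ (Or.inl rfl) ?_
  · rintro a b (rfl | rfl) (rfl | rfl) <;> norm_num
  · intro i _
    unfold commSign₁
    split_ifs <;> simp

lemma normPauli_mul_comm {n : ℕ} (s t : PauliLabel n) :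
    normPauli s * normPauli t = ((commSign s t : ℝ) : ℂ) • (normPauli t * normPauli s) := by
  simp only [normPauli_mul, pauli_mul_comm (s _) (t _), tensorMat_smul, commSign,
    Complex.ofReal_prod]
  rw [smul_comm]

/-- A non-identity string commutes with exactly half of all strings; some site has a non-identity
letter, and the signs already cancel there. -/
lemma sum_commSign {n : ℕ} {s : PauliLabel n} (hs : s ≠ 0) : ∑ t, commSign s t = 0 := by
  obtain ⟨i, hi⟩ := Function.ne_iff.mp hs
  have := Finset.prod_univ_sum (fun _ : Fin n => (Finset.univ : Finset (Fin 4)))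
    (fun i b => commSign₁ (s i) b)
  rw [Fintype.piFinset_univ] at this
  simp only [commSign]
  rw [← this]
  exact Finset.prod_eq_zero (Finset.mem_univ i) (sum_commSign₁ hi)

lemma trace_normPauli {n : ℕ} {s : PauliLabel n} (hs : s ≠ 0) : (normPauli s).trace = 0 := by
  obtain ⟨i, hi⟩ := Function.ne_iff.mp hs
  rw [normPauli_eq, Matrix.trace_smul, trace_tensorMat,
    Finset.prod_eq_zero (Finset.mem_univ i) (trace_pauli hi), smul_zero]

lemma normPauli_zero {n : ℕ} :
    normPauli (0 : PauliLabel n) = (((Real.sqrt 2)⁻¹ : ℝ) : ℂ) ^ n • 1 := by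
  rw [normPauli_eq, ← tensorMat_one]
  simp [pauli]

lemma trace_normPauli_mul_self {n : ℕ} (s : PauliLabel n) :
    (normPauli s * normPauli s).trace = 1 := by
  rw [normPauli_mul_self, Matrix.trace_smul, Matrix.trace_one]
  simp

/-- The completeness relation of the Pauli basis. It factorizes over the sites, where it is the
one-qubit identity `sum_pauli_mul_pauli`. -/
lemma sum_normPauli_mul_normPauli {n : ℕ} (x y x' y' : Fin n → Fin 2) :
    ∑ s : PauliLabel n, normPauli s y x * normPauli s x' y' =
      if x = x' ∧ y = y' then 1 else 0 := by
  have h : ∀ s : PauliLabel n, normPauli s y x * normPauli s x' y' =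
      ∏ i, (1 / 2 : ℂ) * (pauli (s i) (y i) (x i) * pauli (s i) (x' i) (y' i)) := by
    intro s
    simp only [normPauli, Matrix.of_apply, ← Finset.prod_mul_distrib]
    refine Finset.prod_congr rfl fun i _ => ?_
    rw [← inv_sqrt_two_sq]; ring
  have := Finset.prod_univ_sum (fun _ : Fin n => (Finset.univ : Finset (Fin 4)))
    (fun i a => (1 / 2 : ℂ) * (pauli a (y i) (x i) * pauli a (x' i) (y' i)))
  rw [Fintype.piFinset_univ] at this
  simp only [h]
  rw [← this]
  simp only [← Finset.mul_sum, sum_pauli_mul_pauli]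
  split_ifs with hxy
  · obtain ⟨rfl, rfl⟩ := hxy
    simp
  · rw [not_and_or] at hxy
    obtain ⟨i, hi⟩ : ∃ i, ¬ (x i = x' i ∧ y i = y' i) := by
      by_contra! hc
      exact hxy.elim (fun h => h (funext fun i => (hc i).1)) (fun h => h (funext fun i => (hc i).2))
    exact Finset.prod_eq_zero (Finset.mem_univ i) (by simp [hi])

/-- Expansion of a matrix in the Pauli basis. -/
lemma sum_trace_smul_normPauli {n : ℕ} (M : QMat n) :
    ∑ s, (M * normPauli s).trace • normPauli s = M := by
  ext a b
  simp only [Matrix.sum_apply, Matrix.smul_apply, Matrix.trace, Matrix.diag, Matrix.mul_apply,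
    smul_eq_mul, Finset.sum_mul, mul_assoc]
  rw [Finset.sum_comm]
  simp_rw [Finset.sum_comm (s := (Finset.univ : Finset (PauliLabel n))), ← Finset.mul_sum,
    sum_normPauli_mul_normPauli]
  rw [Finset.sum_eq_single a, Finset.sum_eq_single b] <;> simp +contextual

/-! ### Real traces -/

lemma ofReal_trR {n : ℕ} {A B : QMat n} (hA : A.IsHermitian) (hB : B.IsHermitian) :
    ((trR A B : ℝ) : ℂ) = (A * B).trace := by
  rw [trR, ← Complex.conj_eq_iff_re, ← Complex.star_def, ← Matrix.trace_conjTranspose,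
    Matrix.conjTranspose_mul, hA.eq, hB.eq, Matrix.trace_mul_comm]

/-- Expanding `M` in the Pauli basis inside the right-hand side. This is what removes an
intermediate label when paths are summed. -/
lemma sum_trR_mul_trR {n : ℕ} {M : QMat n} (hM : M.IsHermitian) (U B : QMat n) :
    ∑ s, trR M (normPauli s) * trR (U.conjTranspose * normPauli s * U) B =
      trR (U.conjTranspose * M * U) B := by
  have h : U.conjTranspose * M * U * B =
      ∑ s, (trR M (normPauli s) : ℂ) • (U.conjTranspose * normPauli s * U * B) := by
    conv_lhs => rw [← sum_trace_smul_normPauli M]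
    simp only [Matrix.mul_sum, Matrix.sum_mul, Matrix.mul_smul, Matrix.smul_mul,
      ofReal_trR hM (normPauli_isHermitian _)]
  rw [trR, h, Matrix.trace_sum, Complex.re_sum]
  refine Finset.sum_congr rfl fun s _ => ?_
  rw [Matrix.trace_smul, smul_eq_mul, Complex.re_ofReal_mul, ← trR]

lemma sum_trR_sq {n : ℕ} {M : QMat n} (hM : M.IsHermitian) :
    ∑ s, trR M (normPauli s) ^ 2 = trR M M := by
  have h := sum_trR_mul_trR hM 1 M
  simp only [Matrix.conjTranspose_one, one_mul, mul_one] at h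
  rw [← h]
  refine Finset.sum_congr rfl fun s _ => ?_
  rw [sq, trR, trR, Matrix.trace_mul_comm]

lemma zeroProj_isHermitian (n : ℕ) : (zeroProj n).IsHermitian := by
  simp [Matrix.IsHermitian, zeroProj]

lemma trR_zeroProj {n : ℕ} (A : QMat n) : trR A (zeroProj n) = (A 0 0).re := by
  simp [trR, zeroProj, Matrix.trace_mul_single]

lemma trR_comm {n : ℕ} (A B : QMat n) : trR A B = trR B A := by
  rw [trR, trR, Matrix.trace_mul_comm]

lemma conj_isHermitian {n : ℕ} {M : QMat n} (hM : M.IsHermitian) (U : QMat n) :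
    (U.conjTranspose * M * U).IsHermitian :=
  Matrix.isHermitian_conjTranspose_mul_mul U hM

lemma conjTranspose_mul_self_unitary {n : ℕ} (U : QUnitary n) :
    (U : QMat n).conjTranspose * (U : QMat n) = 1 := Matrix.mem_unitaryGroup_iff'.mp U.2

lemma mul_conjTranspose_self_unitary {n : ℕ} (U : QUnitary n) :
    (U : QMat n) * (U : QMat n).conjTranspose = 1 := Matrix.mem_unitaryGroup_iff.mp U.2

lemma trR_conj_self {n : ℕ} (M : QMat n) (U : QUnitary n) :
    trR ((U : QMat n).conjTranspose * M * (U : QMat n))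
      ((U : QMat n).conjTranspose * M * (U : QMat n)) = trR M M := by
  have h : (U : QMat n).conjTranspose * M * (U : QMat n) *
      ((U : QMat n).conjTranspose * M * (U : QMat n)) =
      (U : QMat n).conjTranspose * (M * M * (U : QMat n)) := by
    simp only [mul_assoc]
    rw [← mul_assoc (U : QMat n) (U : QMat n).conjTranspose, mul_conjTranspose_self_unitary,
      one_mul]
  rw [trR, h, Matrix.trace_mul_comm, mul_assoc, mul_conjTranspose_self_unitary, mul_one, trR]

lemma trR_normPauli_self {n : ℕ} (s : PauliLabel n) : trR (normPauli s) (normPauli s) = 1 := by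
  rw [trR, trace_normPauli_mul_self, Complex.one_re]

lemma conj_normPauli_zero {n : ℕ} (U : QUnitary n) :
    (U : QMat n).conjTranspose * normPauli 0 * (U : QMat n) = normPauli 0 := by
  simp [normPauli_zero, conjTranspose_mul_self_unitary]

lemma trR_conj_zero_left {n : ℕ} (U : QUnitary n) {s : PauliLabel n} (hs : s ≠ 0) :
    trR ((U : QMat n).conjTranspose * normPauli 0 * (U : QMat n)) (normPauli s) = 0 := by
  rw [conj_normPauli_zero, normPauli_zero, trR, Matrix.smul_mul, one_mul, Matrix.trace_smul,
    trace_normPauli hs, smul_zero, Complex.zero_re]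

lemma trR_conj_zero_right {n : ℕ} (U : QUnitary n) {r : PauliLabel n} (hr : r ≠ 0) :
    trR ((U : QMat n).conjTranspose * normPauli r * (U : QMat n)) (normPauli 0) = 0 := by
  rw [normPauli_zero, trR, Matrix.mul_smul, mul_one, Matrix.trace_smul, mul_assoc,
    Matrix.trace_mul_comm, mul_assoc, mul_conjTranspose_self_unitary, mul_one,
    trace_normPauli hr, smul_zero, Complex.zero_re]

lemma trR_normPauli_zero_zeroProj_sq (n : ℕ) :
    trR (normPauli 0) (zeroProj n) * trR (normPauli 0) (zeroProj n) = 1 / 2 ^ n := by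
  have h : ((trR (normPauli 0) (zeroProj n) : ℝ) : ℂ) * (trR (normPauli 0) (zeroProj n) : ℝ)
      = 1 / 2 ^ n := by
    rw [ofReal_trR (normPauli_isHermitian _) (zeroProj_isHermitian n), ← inv_sqrt_two_pow_sq]
    simp [normPauli_zero, zeroProj]
  rw [← Complex.ofReal_inj]
  push_cast
  exact h

/-- A Pauli string rescaled to a unitary. -/
lemma sqrt_smul_normPauli_mem {n : ℕ} (s : PauliLabel n) :
    (((Real.sqrt 2 : ℝ) : ℂ) ^ n • normPauli s) ∈ Matrix.unitaryGroup (Fin n → Fin 2) ℂ := by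
  rw [Matrix.mem_unitaryGroup_iff, Matrix.star_eq_conjTranspose, Matrix.conjTranspose_smul,
    (normPauli_isHermitian s).eq, smul_mul_smul_comm, normPauli_mul_self, smul_smul, star_pow,
    Complex.star_def, Complex.conj_ofReal, ← mul_pow, ← Complex.ofReal_mul,
    Real.mul_self_sqrt (by norm_num)]
  simp

/-- The rescaled string `√2ⁿ s` is unitary, hence so is its conjugate by `U`, and entries of a
unitary have modulus at most 1. -/
lemma trR_conj_zeroProj_sq_le {n : ℕ} (s : PauliLabel n) (U : QUnitary n) :
    trR ((U : QMat n).conjTranspose * normPauli s * (U : QMat n)) (zeroProj n) ^ 2 ≤ 1 / 2 ^ n := by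
  have hmem : (star U * ⟨_, sqrt_smul_normPauli_mem s⟩ * U : QUnitary n).1 ∈
      Matrix.unitaryGroup (Fin n → Fin 2) ℂ := Subtype.property _
  have h := entry_norm_bound_of_unitary hmem 0 0
  have he : (star U * ⟨_, sqrt_smul_normPauli_mem s⟩ * U : QUnitary n).1 =
      ((Real.sqrt 2 : ℝ) : ℂ) ^ n • ((U : QMat n).conjTranspose * normPauli s * (U : QMat n)) := by
    simp [Matrix.star_eq_conjTranspose]
  rw [he, Matrix.smul_apply, norm_smul, norm_pow, Complex.norm_real, Real.norm_of_nonneg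
    (Real.sqrt_nonneg 2)] at h
  rw [trR_zeroProj, le_div_iff₀ (by positivity)]
  have h2 : (2 : ℝ) ^ n = (Real.sqrt 2 ^ n) ^ 2 := by
    rw [← pow_mul, mul_comm n 2, pow_mul, Real.sq_sqrt (by norm_num)]
  rw [h2, ← mul_pow, mul_comm, sq_le_one_iff_abs_le_one, abs_mul, abs_of_nonneg (by positivity)]
  exact (mul_le_mul_of_nonneg_left (Complex.abs_re_le_norm _) (by positivity)).trans h

lemma trR_zeroProj_normPauli_sq_le {n : ℕ} (s : PauliLabel n) :
    trR (zeroProj n) (normPauli s) ^ 2 ≤ 1 / 2 ^ n := by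
  have := trR_conj_zeroProj_sq_le s 1
  rw [trR_comm]
  simpa using this

/-! ### Integration over unitaries -/

instance instSecondCountableTopologyQUnitary (n : ℕ) : SecondCountableTopology (QUnitary n) :=
  haveI : SecondCountableTopology (QMat n) :=
    inferInstanceAs (SecondCountableTopology ((Fin n → Fin 2) → (Fin n → Fin 2) → ℂ))
  TopologicalSpace.Subtype.secondCountableTopology
    (Matrix.unitaryGroup (Fin n → Fin 2) ℂ : Set (QMat n))

lemma integrable_of_continuous {X E : Type*} [TopologicalSpace X] [CompactSpace X]
    [MeasurableSpace X] [OpensMeasurableSpace X] [NormedAddCommGroup E]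
    [SecondCountableTopology E] {μ : Measure X}
    [IsFiniteMeasure μ] {f : X → E} (hf : Continuous f) : Integrable f μ := by
  let _ : MeasurableSpace E := borel E
  have : BorelSpace E := ⟨rfl⟩
  obtain ⟨C, hC⟩ := (isCompact_range hf).isBounded.exists_norm_le
  exact Integrable.of_bound hf.aestronglyMeasurable C
    (ae_of_all _ fun x => hC _ (Set.mem_range_self x))

instance instIsProbabilityMeasureHaarUnitary (n : ℕ) : IsProbabilityMeasure (haarUnitary n) :=
  ⟨Measure.haarMeasure_self (K₀ := (⊤ : TopologicalSpace.PositiveCompacts (QUnitary n)))⟩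

@[fun_prop]
lemma continuous_trR {X : Type*} [TopologicalSpace X] {n : ℕ} {f g : X → QMat n}
    (hf : Continuous f) (hg : Continuous g) : Continuous fun x => trR (f x) (g x) := by
  unfold trR
  exact Complex.continuous_re.comp (hf.matrix_mul hg).matrix_trace

lemma continuous_trR_conj {n : ℕ} (A B : QMat n) :
    Continuous fun U : QUnitary n => trR ((U : QMat n).conjTranspose * A * (U : QMat n)) B := by
  fun_prop

/-! ### Second moments of the Haar measure -/

lemma trR_conj_eq {n : ℕ} (U A B : QMat n) :
    trR (U.conjTranspose * A * U) B = trR (U * B * U.conjTranspose) A := by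
  rw [trR, trR, mul_assoc, mul_assoc, Matrix.trace_mul_comm, mul_assoc, Matrix.trace_mul_comm A,
    mul_assoc]

lemma sum_trR_conj_sq {n : ℕ} (U : QUnitary n) {B : QMat n} (hB : B.IsHermitian) :
    ∑ t, trR ((U : QMat n).conjTranspose * normPauli t * (U : QMat n)) B ^ 2 = trR B B := by
  simp only [trR_conj_eq]
  have h := trR_conj_self B (star U)
  have h2 := sum_trR_sq (conj_isHermitian hB (star U : QUnitary n))
  rw [h] at h2
  simpa [Matrix.star_eq_conjTranspose] using h2

/-- Anticommuting Pauli strings are unitarily conjugate. -/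
lemma exists_unitary_conj {n : ℕ} {r t : PauliLabel n} (h : commSign r t = -1) :
    ∃ W : QUnitary n,
      (W : QMat n).conjTranspose * normPauli r * (W : QMat n) = normPauli t := by
  have hrt : normPauli r * normPauli t = -(normPauli t * normPauli r) := by
    rw [normPauli_mul_comm, h]; simp
  -- For anticommuting `r` and `t` the square of the sum of the normalized strings is `2/2ⁿ`, so
  -- this factor makes the sum unitary. It is Hermitian and swaps the two strings under conjugation.
  set c : ℂ := ((Real.sqrt (2 ^ n / 2) : ℝ) : ℂ) with hc
  have hcc : c * c = 2 ^ n / 2 := by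
    rw [hc, ← Complex.ofReal_mul, Real.mul_self_sqrt (by positivity)]; simp
  have hstar : (c • (normPauli r + normPauli t)).conjTranspose =
      c • (normPauli r + normPauli t) := by
    rw [Matrix.conjTranspose_smul, Matrix.conjTranspose_add, (normPauli_isHermitian r).eq,
      (normPauli_isHermitian t).eq, hc, Complex.star_def, Complex.conj_ofReal]
  have hp : (2 : ℂ) ^ n ≠ 0 := by positivity
  refine ⟨⟨c • (normPauli r + normPauli t), ?_⟩, ?_⟩
  · rw [Matrix.mem_unitaryGroup_iff, Matrix.star_eq_conjTranspose, hstar, smul_mul_smul_comm, hcc,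
      add_mul, mul_add, mul_add, normPauli_mul_self, normPauli_mul_self, hrt]
    have : ((1 : ℂ) / 2 ^ n) • (1 : QMat n) + -(normPauli t * normPauli r) +
        (normPauli t * normPauli r + ((1 : ℂ) / 2 ^ n) • 1) = ((2 : ℂ) / 2 ^ n) • 1 := by
      rw [show (2 : ℂ) / 2 ^ n = 1 / 2 ^ n + 1 / 2 ^ n by ring, add_smul]
      abel
    rw [this, smul_smul]
    field_simp
    simp
  · simp only [hstar]
    rw [Matrix.smul_mul, smul_mul_smul_comm, hcc]
    have h1 : (normPauli r + normPauli t) * normPauli r * (normPauli r + normPauli t) =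
        ((2 : ℂ) / 2 ^ n) • normPauli t := by
      have e : normPauli t * normPauli r * normPauli t = -(((1 : ℂ) / 2 ^ n) • normPauli r) := by
        rw [mul_assoc, hrt, mul_neg, ← mul_assoc, normPauli_mul_self, Matrix.smul_mul, one_mul]
      rw [add_mul, add_mul, mul_add, mul_add, e, normPauli_mul_self, mul_assoc (normPauli t),
        normPauli_mul_self, Matrix.smul_mul, Matrix.smul_mul, Matrix.mul_smul, one_mul, one_mul,
        mul_one, show (2 : ℂ) / 2 ^ n = 1 / 2 ^ n + 1 / 2 ^ n by ring, add_smul]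
      abel
    rw [h1, smul_smul]
    field_simp
    simp

lemma haar_moment_eq {n : ℕ} {r t : PauliLabel n} (h : commSign r t = -1) (B : QMat n) :
    ∫ U : QUnitary n, trR ((U : QMat n).conjTranspose * normPauli t * (U : QMat n)) B ^ 2
        ∂haarUnitary n =
      ∫ U : QUnitary n, trR ((U : QMat n).conjTranspose * normPauli r * (U : QMat n)) B ^ 2
        ∂haarUnitary n := by
  obtain ⟨W, hW⟩ := exists_unitary_conj h
  have : (haarUnitary n).IsMulLeftInvariant := by unfold haarUnitary; infer_instance
  rw [← integral_mul_left_eq_self (μ := haarUnitary n) (fun U : QUnitary n =>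
    trR ((U : QMat n).conjTranspose * normPauli r * (U : QMat n)) B ^ 2) W]
  refine integral_congr_ae (ae_of_all _ fun U => ?_)
  simp only [Submonoid.coe_mul, Matrix.conjTranspose_mul, ← hW, mul_assoc]

/-- By Haar invariance the moment takes the same value at `r` and at every `t` anticommuting with
`r`. These are half of the `4ⁿ` strings, while the moments of all strings add up to `Tr B²` by
Parseval. The weight `1 - commSign r t` is 2 on those `t` and 0 elsewhere. -/
lemma haar_moment_le {n : ℕ} {r : PauliLabel n} (hr : r ≠ 0) {B : QMat n} (hB : B.IsHermitian) :
    ∫ U : QUnitary n, trR ((U : QMat n).conjTranspose * normPauli r * (U : QMat n)) B ^ 2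
        ∂haarUnitary n ≤ 2 / 4 ^ n * trR B B := by
  set G : PauliLabel n → ℝ := fun t =>
    ∫ U : QUnitary n, trR ((U : QMat n).conjTranspose * normPauli t * (U : QMat n)) B ^ 2
      ∂haarUnitary n with hG
  have hsum : ∑ t, G t = trR B B := by
    rw [hG, ← integral_finsetSum]
    · simp [sum_trR_conj_sq _ hB]
    · intro t _
      exact integrable_of_continuous ((continuous_trR_conj _ _).pow 2)
  have hnn : ∀ t, 0 ≤ G t := fun t => integral_nonneg fun _ => sq_nonneg _
  have h1 : ∑ t, (1 - commSign r t) * G r = 4 ^ n * G r := by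
    rw [← Finset.sum_mul, Finset.sum_sub_distrib, sum_commSign hr]
    simp
  have h2 : ∑ t, (1 - commSign r t) * G r ≤ ∑ t, 2 * G t := by
    refine Finset.sum_le_sum fun t _ => ?_
    rcases commSign_eq_one_or r t with h | h
    · rw [h]; simpa using hnn t
    · rw [h, show G t = G r from haar_moment_eq h B]
      exact le_of_eq (by ring)
  rw [h1, ← Finset.mul_sum, hsum] at h2
  change G r ≤ _
  rw [div_mul_eq_mul_div, le_div_iff₀ (by positivity)]
  linarith

/-! ### The trace norm -/

/-- Compute the trace in an eigenbasis `V` of `X† X`. Each diagonal term pairs a row of `V† W`, of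
norm one, with a column of `X V`, whose norm is a singular value of `X`; Cauchy–Schwarz finishes. -/
lemma norm_trace_mul_le_traceNorm {m : Type*} [Fintype m] [DecidableEq m] {W : Matrix m m ℂ}
    (hW : W ∈ Matrix.unitaryGroup m ℂ) (X : Matrix m m ℂ) : ‖(W * X).trace‖ ≤ traceNorm X := by
  set h := Matrix.isHermitian_conjTranspose_mul_self X
  set V : Matrix m m ℂ := (h.eigenvectorUnitary : Matrix m m ℂ) with hV
  have hVV : V * V.conjTranspose = 1 := Matrix.mem_unitaryGroup_iff.mp h.eigenvectorUnitary.2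
  have hVV' : V.conjTranspose * V = 1 := Matrix.mem_unitaryGroup_iff'.mp h.eigenvectorUnitary.2
  have hWW : W * W.conjTranspose = 1 := Matrix.mem_unitaryGroup_iff.mp hW
  have htr : (W * X).trace = (V.conjTranspose * W * (X * V)).trace := by
    rw [Matrix.trace_mul_comm _ (X * V), mul_assoc X, ← mul_assoc V, hVV, one_mul,
      Matrix.trace_mul_comm]
  have hdiag : ∀ i, ∑ j, ‖(X * V) j i‖ ^ 2 = h.eigenvalues i := by
    intro i
    have hs : V.conjTranspose * (X.conjTranspose * X) * V =
        Matrix.diagonal (fun i => (h.eigenvalues i : ℂ)) := by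
      have := h.conjStarAlgAut_star_eigenvectorUnitary
      rw [Unitary.conjStarAlgAut_apply] at this
      simpa [Matrix.star_eq_conjTranspose, Function.comp_def] using this
    have h1 : ((X * V).conjTranspose * (X * V)) i i = (h.eigenvalues i : ℂ) := by
      rw [Matrix.conjTranspose_mul, mul_assoc, ← mul_assoc X.conjTranspose, ← mul_assoc, hs,
        Matrix.diagonal_apply_eq]
    rw [← Complex.ofReal_inj, ← h1, Matrix.mul_apply]
    push_cast
    refine Finset.sum_congr rfl fun j _ => ?_
    rw [Matrix.conjTranspose_apply, Complex.star_def, Complex.conj_mul']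
  have hrow : ∀ i, ∑ j, ‖(V.conjTranspose * W) i j‖ ^ 2 = 1 := by
    intro i
    have h1 : ((V.conjTranspose * W) * (V.conjTranspose * W).conjTranspose) i i = (1 : ℂ) := by
      rw [Matrix.conjTranspose_mul, mul_assoc, ← mul_assoc W, hWW, one_mul,
        Matrix.conjTranspose_conjTranspose, hVV', Matrix.one_apply_eq]
    rw [← Complex.ofReal_inj, Complex.ofReal_one, ← h1, Matrix.mul_apply]
    push_cast
    refine Finset.sum_congr rfl fun j _ => ?_
    rw [Matrix.conjTranspose_apply, Complex.star_def, Complex.mul_conj']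
  rw [htr, traceNorm, Matrix.trace]
  refine (norm_sum_le _ _).trans (Finset.sum_le_sum fun i _ => ?_)
  rw [Matrix.diag_apply, Matrix.mul_apply]
  refine (norm_sum_le _ _).trans ?_
  simp only [norm_mul]
  refine (Real.sum_mul_le_sqrt_mul_sqrt _ _ _).trans ?_
  rw [hrow, Real.sqrt_one, one_mul, hdiag]

lemma traceNorm_nonneg {m : Type*} [Fintype m] [DecidableEq m] (A : Matrix m m ℂ) :
    0 ≤ traceNorm A := Finset.sum_nonneg fun _ _ => Real.sqrt_nonneg _

/-! ### Second moments of approximate 2-designs -/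

lemma IsApproxTwoDesign.traceNorm_le {n : ℕ} {D : Measure (QUnitary n)} {ε : ℝ}
    (h : IsApproxTwoDesign D ε)
    {ρ : Matrix ((Fin n → Fin 2) × (Fin n → Fin 2)) ((Fin n → Fin 2) × (Fin n → Fin 2)) ℂ}
    (hρ : IsState ρ) :
    traceNorm (secondMoment (haarUnitary n) ρ - secondMoment D ρ) ≤ ε :=
  EReal.coe_le_coe_iff.mp ((le_iSup₂ (f := fun (ρ : Matrix ((Fin n → Fin 2) × (Fin n → Fin 2))
    ((Fin n → Fin 2) × (Fin n → Fin 2)) ℂ) (_ : IsState ρ) =>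
      ((traceNorm (secondMoment (haarUnitary n) ρ - secondMoment D ρ) : ℝ) : EReal)) ρ hρ).trans h)

lemma continuous_kronecker_conj {n : ℕ}
    (A : Matrix ((Fin n → Fin 2) × (Fin n → Fin 2)) ((Fin n → Fin 2) × (Fin n → Fin 2)) ℂ) :
    Continuous fun U : QUnitary n => ((U : QMat n) ⊗ₖ (U : QMat n)) * A *
      ((U : QMat n) ⊗ₖ (U : QMat n)).conjTranspose := by
  have hk : Continuous fun U : QUnitary n => (U : QMat n) ⊗ₖ (U : QMat n) := by
    refine continuous_matrix fun i j => ?_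
    simp only [Matrix.kroneckerMap_apply]
    exact (continuous_subtype_val.matrix_elem _ _).mul (continuous_subtype_val.matrix_elem _ _)
  exact (hk.matrix_mul continuous_const).matrix_mul hk.matrix_conjTranspose

lemma trace_mul_secondMoment {n : ℕ} (D : Measure (QUnitary n)) [IsProbabilityMeasure D]
    (R A : Matrix ((Fin n → Fin 2) × (Fin n → Fin 2)) ((Fin n → Fin 2) × (Fin n → Fin 2)) ℂ) :
    (R * secondMoment D A).trace = ∫ U : QUnitary n,
      (R * (((U : QMat n) ⊗ₖ (U : QMat n)) * A *
        ((U : QMat n) ⊗ₖ (U : QMat n)).conjTranspose)).trace ∂D := by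
  have hc := continuous_kronecker_conj A
  have hi : ∀ i j, Integrable (fun U : QUnitary n => R i j *
      (((U : QMat n) ⊗ₖ (U : QMat n)) * A * ((U : QMat n) ⊗ₖ (U : QMat n)).conjTranspose) j i)
      D := fun i j => integrable_of_continuous (continuous_const.mul (hc.matrix_elem j i))
  simp only [Matrix.trace, Matrix.diag_apply, Matrix.mul_apply (M := R)]
  rw [integral_finsetSum _ fun i _ => integrable_finsetSum _ fun j _ => hi i j]
  refine Finset.sum_congr rfl fun i _ => ?_
  rw [integral_finsetSum _ fun j _ => hi i j]
  refine Finset.sum_congr rfl fun j _ => ?_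
  rw [integral_const_mul]
  rfl

/-- Two copies turn the square of a trace into a single trace, so second moments become linear
functionals of the channel and the design hypothesis applies to them. -/
lemma trace_kronecker_mul_secondMoment {n : ℕ} (D : Measure (QUnitary n))
    [IsProbabilityMeasure D] {M B : QMat n} (hM : M.IsHermitian) (hB : B.IsHermitian) :
    ((M ⊗ₖ M) * secondMoment D (B ⊗ₖ B)).trace =
      ((∫ U : QUnitary n, trR ((U : QMat n).conjTranspose * M * (U : QMat n)) B ^ 2 ∂D : ℝ) :
        ℂ) := by
  rw [trace_mul_secondMoment, ← integral_complex_ofReal]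
  refine integral_congr_ae (ae_of_all _ fun U => ?_)
  simp only
  rw [Complex.ofReal_pow, ofReal_trR (conj_isHermitian hM _) hB, Matrix.conjTranspose_kronecker,
    ← Matrix.mul_kronecker_mul, ← Matrix.mul_kronecker_mul, ← Matrix.mul_kronecker_mul,
    Matrix.trace_kronecker, sq]
  have : (M * ((U : QMat n) * B * (U : QMat n).conjTranspose)).trace =
      ((U : QMat n).conjTranspose * M * (U : QMat n) * B).trace := by
    rw [← mul_assoc, Matrix.trace_mul_comm]
    simp only [mul_assoc]
  rw [this]

lemma two_pow_smul_kronecker_mem {n : ℕ} (s : PauliLabel n) :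
    ((2 : ℂ) ^ n • (normPauli s ⊗ₖ normPauli s)) ∈
      Matrix.unitaryGroup ((Fin n → Fin 2) × (Fin n → Fin 2)) ℂ := by
  rw [Matrix.mem_unitaryGroup_iff, Matrix.star_eq_conjTranspose, Matrix.conjTranspose_smul,
    Matrix.conjTranspose_kronecker, (normPauli_isHermitian s).eq, smul_mul_smul_comm,
    ← Matrix.mul_kronecker_mul, normPauli_mul_self, Matrix.smul_kronecker, Matrix.kronecker_smul,
    Matrix.one_kronecker_one, smul_smul, smul_smul]
  have : star ((2 : ℂ) ^ n) = 2 ^ n := by simp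
  rw [this]
  field_simp
  simp

/-- The gain `2⁻ⁿ` comes from the normalization: `2ⁿ (r ⊗ r)` is the unitary to which trace-norm
duality is applied. -/
lemma IsApproxTwoDesign.norm_trace_sub_le {n : ℕ} {D : Measure (QUnitary n)} {ε : ℝ}
    (h : IsApproxTwoDesign D ε) (r : PauliLabel n)
    {ρ : Matrix ((Fin n → Fin 2) × (Fin n → Fin 2)) ((Fin n → Fin 2) × (Fin n → Fin 2)) ℂ}
    (hρ : IsState ρ) :
    ‖((normPauli r ⊗ₖ normPauli r) * secondMoment (haarUnitary n) ρ).trace -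
      ((normPauli r ⊗ₖ normPauli r) * secondMoment D ρ).trace‖ ≤ ε / 2 ^ n := by
  have h1 := (norm_trace_mul_le_traceNorm (two_pow_smul_kronecker_mem r) _).trans
    (h.traceNorm_le hρ)
  rw [Matrix.smul_mul, Matrix.trace_smul, norm_smul, mul_sub, Matrix.trace_sub] at h1
  rw [le_div_iff₀ (by positivity), mul_comm]
  simpa using h1

lemma isState_zeroProj_kronecker (n : ℕ) : IsState (zeroProj n ⊗ₖ zeroProj n) := by
  have h : zeroProj n ⊗ₖ zeroProj n =
      (zeroProj n ⊗ₖ zeroProj n).conjTranspose * (zeroProj n ⊗ₖ zeroProj n) := by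
    rw [Matrix.conjTranspose_kronecker, (zeroProj_isHermitian n).eq, ← Matrix.mul_kronecker_mul]
    simp [zeroProj]
  refine ⟨?_, ?_⟩
  · rw [h]
    exact Matrix.posSemidef_conjTranspose_mul_self _
  · rw [Matrix.trace_kronecker]
    simp [zeroProj]

lemma IsApproxTwoDesign.nonneg {n : ℕ} {D : Measure (QUnitary n)} {ε : ℝ}
    (h : IsApproxTwoDesign D ε) : 0 ≤ ε :=
  (traceNorm_nonneg _).trans (h.traceNorm_le (isState_zeroProj_kronecker n))

lemma IsApproxTwoDesign.moment_zeroProj_le {n : ℕ} {D : Measure (QUnitary n)}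
    [IsProbabilityMeasure D] {ε : ℝ} (h : IsApproxTwoDesign D ε) {r : PauliLabel n} (hr : r ≠ 0) :
    ∫ U : QUnitary n, trR ((U : QMat n).conjTranspose * normPauli r * (U : QMat n)) (zeroProj n) ^ 2
      ∂D ≤ 2 / 4 ^ n + ε / 2 ^ n := by
  have h1 := h.norm_trace_sub_le r (isState_zeroProj_kronecker n)
  rw [trace_kronecker_mul_secondMoment _ (normPauli_isHermitian r) (zeroProj_isHermitian n),
    trace_kronecker_mul_secondMoment _ (normPauli_isHermitian r) (zeroProj_isHermitian n),
    ← Complex.ofReal_sub, Complex.norm_real, Real.norm_eq_abs] at h1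
  have h2 := haar_moment_le hr (zeroProj_isHermitian n)
  have h3 : trR (zeroProj n) (zeroProj n) = 1 := by
    rw [trR_zeroProj]
    simp [zeroProj]
  rw [h3, mul_one] at h2
  linarith [(abs_le.mp h1).1]

/-- The state `(1 + P ⊗ P) / 4ⁿ` of a non-identity Pauli string `P`. -/
lemma isState_one_add_kronecker {n : ℕ} {s : PauliLabel n} (hs : s ≠ 0) :
    IsState (((1 : ℂ) / 4 ^ n) • (1 + (2 : ℂ) ^ n • (normPauli s ⊗ₖ normPauli s))) := by
  set Q := (2 : ℂ) ^ n • (normPauli s ⊗ₖ normPauli s) with hQ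
  have hQH : Q.conjTranspose = Q := by
    rw [hQ, Matrix.conjTranspose_smul, Matrix.conjTranspose_kronecker, (normPauli_isHermitian s).eq]
    simp
  have hQQ : Q * Q = 1 := by
    have := Matrix.mem_unitaryGroup_iff.mp (two_pow_smul_kronecker_mem s)
    rwa [Matrix.star_eq_conjTranspose, ← hQ, hQH] at this
  constructor
  -- As `Q` is a Hermitian involution, `(1 + Q)² = 2 (1 + Q)`, which exhibits positivity.
  · have h1 : ((1 : ℂ) / 4 ^ n) • (1 + Q) =
        ((1 : ℂ) / (2 * 4 ^ n)) • ((1 + Q).conjTranspose * (1 + Q)) := by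
      rw [Matrix.conjTranspose_add, Matrix.conjTranspose_one, hQH, add_mul, mul_add, mul_add, hQQ,
        one_mul, one_mul, mul_one, add_comm Q 1, ← two_smul ℂ (1 + Q), smul_smul]
      congr 1
      field_simp
    rw [h1]
    refine (Matrix.posSemidef_conjTranspose_mul_self _).smul ?_
    have : (0 : ℝ) ≤ 1 / (2 * 4 ^ n) := by positivity
    have := Complex.zero_le_real.mpr this
    push_cast at this
    exact this
  · rw [Matrix.trace_smul, Matrix.trace_add, hQ, Matrix.trace_smul, Matrix.trace_kronecker,
      trace_normPauli hs, Matrix.trace_one]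
    simp only [Fintype.card_prod, Fintype.card_pi, Fintype.card_fin, Finset.prod_const,
      Finset.card_univ, smul_eq_mul, mul_zero, add_zero]
    push_cast
    rw [← mul_pow]
    norm_num

lemma trace_mul_secondMoment_one_add {n : ℕ} (D : Measure (QUnitary n)) [IsProbabilityMeasure D]
    (a c : ℂ) (R A : Matrix ((Fin n → Fin 2) × (Fin n → Fin 2))
      ((Fin n → Fin 2) × (Fin n → Fin 2)) ℂ) :
    (R * secondMoment D (a • (1 + c • A))).trace =
      a * (R.trace + c * (R * secondMoment D A).trace) := by
  have h : secondMoment D (a • (1 + c • A)) = a • (1 + c • secondMoment D A) := by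
    have h1 : ∀ U : QUnitary n, ((U : QMat n) ⊗ₖ (U : QMat n)) *
        ((U : QMat n) ⊗ₖ (U : QMat n)).conjTranspose = 1 := fun U => by
      rw [Matrix.conjTranspose_kronecker, ← Matrix.mul_kronecker_mul,
        mul_conjTranspose_self_unitary, Matrix.one_kronecker_one]
    ext i j
    simp only [secondMoment, Matrix.of_apply, Matrix.mul_smul, Matrix.smul_mul, mul_add, add_mul,
      mul_one, h1, Matrix.smul_apply, Matrix.add_apply, smul_eq_mul]
    rw [integral_add (integrable_const _), integral_const_mul]
    · rw [integral_const_mul, integral_const_mul, integral_const, probReal_univ, one_smul]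
    · refine Integrable.const_mul ?_ a
      exact integrable_of_continuous
        (continuous_const.mul ((continuous_kronecker_conj A).matrix_elem i j))
  rw [h, Matrix.mul_smul, mul_add, mul_one, Matrix.mul_smul, Matrix.trace_smul, Matrix.trace_add,
    Matrix.trace_smul, smul_eq_mul, smul_eq_mul]

/-- The operator `s ⊗ s` is not a state, so the hypothesis is tested on `(1 + 2ⁿ s ⊗ s) / 4ⁿ`. The
identity part is fixed by both channels and cancels. The remaining coefficient `2ⁿ/4ⁿ` consumes the
gain `2⁻ⁿ`, which leaves an error `ε` instead of `ε/2ⁿ`. -/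
lemma IsApproxTwoDesign.moment_normPauli_le {n : ℕ} {D : Measure (QUnitary n)}
    [IsProbabilityMeasure D] {ε : ℝ} (h : IsApproxTwoDesign D ε) {r s : PauliLabel n} (hr : r ≠ 0)
    (hs : s ≠ 0) :
    ∫ U : QUnitary n, trR ((U : QMat n).conjTranspose * normPauli r * (U : QMat n))
      (normPauli s) ^ 2
      ∂D ≤ 2 / 4 ^ n + ε := by
  have h1 := h.norm_trace_sub_le r (isState_one_add_kronecker hs)
  rw [trace_mul_secondMoment_one_add, trace_mul_secondMoment_one_add,
    trace_kronecker_mul_secondMoment _ (normPauli_isHermitian r) (normPauli_isHermitian s),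
    trace_kronecker_mul_secondMoment _ (normPauli_isHermitian r) (normPauli_isHermitian s),
    ← mul_sub, add_sub_add_left_eq_sub, ← mul_sub, ← Complex.ofReal_sub, ← mul_assoc, norm_mul,
    Complex.norm_real, Real.norm_eq_abs] at h1
  have h4 : ‖(1 : ℂ) / 4 ^ n * 2 ^ n‖ = 1 / 2 ^ n := by
    rw [show (4 : ℂ) = 2 * 2 by norm_num, mul_pow]
    field_simp
    simp
  rw [h4, div_mul_eq_mul_div, one_mul, div_le_div_iff_of_pos_right (by positivity)] at h1
  have h2 := haar_moment_le hr (normPauli_isHermitian s)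
  rw [trR_normPauli_self, mul_one] at h2
  linarith [(abs_le.mp h1).1]

/-! ### Sums over Pauli paths -/

/-- In Parseval's identity for `normPauli r` the term at `r` already exhausts the total 1. -/
lemma trR_normPauli_of_ne {n : ℕ} {r s : PauliLabel n} (h : r ≠ s) :
    trR (normPauli r) (normPauli s) = 0 := by
  have h1 := sum_trR_sq (normPauli_isHermitian r)
  rw [trR_normPauli_self, ← Finset.add_sum_erase _ _ (Finset.mem_univ r), trR_normPauli_self,
    one_pow, add_eq_left, Finset.sum_eq_zero_iff_of_nonneg fun _ _ => sq_nonneg _] at h1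
  exact pow_eq_zero_iff two_ne_zero |>.mp (h1 s (by simp [h.symm]))

lemma circuitUnitary_succ {n L : ℕ} (u : Fin (L + 1) → QUnitary n) :
    circuitUnitary u = u (Fin.last L) * circuitUnitary fun i : Fin L => u i.castSucc := by
  rw [circuitUnitary, List.ofFn_succ', List.concat_eq_append, List.reverse_append, List.prod_append]
  simp [circuitUnitary]

lemma circuitUnitary_of_isEmpty {n : ℕ} (u : Fin 0 → QUnitary n) : circuitUnitary u = 1 := by
  simp [circuitUnitary]

/-- The product `∏_j Tr[U_j† s_j U_j s_{j-1}]` of transition amplitudes along a path. -/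
noncomputable def pathWeight {n L : ℕ} (u : Fin L → QUnitary n) (γ : PauliPath n L) : ℝ :=
  ∏ j : Fin L, trR ((u j : QMat n).conjTranspose * normPauli (γ j.succ) * (u j : QMat n))
    (normPauli (γ j.castSucc))

lemma pathWeight_snoc {n L : ℕ} (u : Fin (L + 1) → QUnitary n) (γ : PauliPath n L)
    (a : PauliLabel n) :
    pathWeight u (Fin.snoc γ a : PauliPath n (L + 1)) =
      pathWeight (fun i : Fin L => u i.castSucc) γ *
        trR ((u (Fin.last L) : QMat n).conjTranspose * normPauli a * (u (Fin.last L) : QMat n))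
          (normPauli (γ (Fin.last L))) := by
  simp only [pathWeight, Fin.prod_univ_castSucc, Fin.succ_castSucc, Fin.succ_last,
    Fin.snoc_castSucc, Fin.snoc_last]

/-- Peels off the last layer. The general `g` lets one recursion serve both the plain sum over paths
and the sum with a prescribed label at the cut. -/
lemma sum_pathWeight_succ {n L : ℕ} (u : Fin (L + 1) → QUnitary n) (r : PauliLabel n)
    (g : PauliPath n L → ℝ) :
    ∑ γ : PauliPath n (L + 1) with γ (Fin.last _) = r,
        pathWeight u γ * g (fun i => γ i.castSucc) =
      ∑ b, trR ((u (Fin.last L) : QMat n).conjTranspose * normPauli r * (u (Fin.last L) : QMat n))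
          (normPauli b) *
        ∑ γ : PauliPath n L with γ (Fin.last _) = b,
          pathWeight (fun i : Fin L => u i.castSucc) γ * g γ := by
  rw [Finset.sum_filter, ← (Fin.snocEquiv fun _ : Fin (L + 2) => PauliLabel n).sum_comp,
    Fintype.sum_prod_type]
  simp only [Fin.snocEquiv, Equiv.coe_fn_mk, Fin.snoc_last, Fin.snoc_castSucc]
  rw [Finset.sum_eq_single r _ (by simp)]
  · simp only [if_true]
    rw [← Finset.sum_fiberwise _ (fun γ : PauliPath n L => γ (Fin.last L))]
    refine Finset.sum_congr rfl fun b _ => ?_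
    rw [Finset.mul_sum]
    refine Finset.sum_congr rfl fun γ hγ => ?_
    rw [Finset.mem_filter] at hγ
    rw [pathWeight_snoc, hγ.2]
    ring
  · intro a _ ha
    simp [ha]

lemma sum_pathWeight {n L : ℕ} (u : Fin L → QUnitary n) (r : PauliLabel n) (B : QMat n) :
    ∑ γ : PauliPath n L with γ (Fin.last _) = r, pathWeight u γ * trR (normPauli (γ 0)) B =
      trR ((circuitUnitary u : QMat n).conjTranspose * normPauli r * (circuitUnitary u : QMat n))
        B := by
  induction L generalizing r with
  | zero =>
    have : ({γ : PauliPath n 0 | γ (Fin.last 0) = r} : Finset (PauliPath n 0)) = {fun _ => r} := by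
      ext γ
      simp only [Finset.mem_filter, Finset.mem_univ, true_and, Finset.mem_singleton]
      exact ⟨fun h => funext fun i => by rw [Fin.eq_zero i]; exact h, fun h => by rw [h]⟩
    rw [this, Finset.sum_singleton, circuitUnitary_of_isEmpty]
    simp [pathWeight]
  | succ L ih =>
    have h := sum_pathWeight_succ u r fun γ => trR (normPauli (γ 0)) B
    simp only [ih, Fin.castSucc_zero] at h
    rw [sum_trR_mul_trR (conj_isHermitian (normPauli_isHermitian r) _)] at h
    rw [circuitUnitary_succ]
    simpa only [Submonoid.coe_mul, Matrix.conjTranspose_mul, mul_assoc] using h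

/-- Induction on the layers after the cut: completeness merges them into one unitary. With no such
layer the cut is the last index, and orthonormality of the strings produces the condition `r = s`.
-/
lemma sum_pathWeight_cut {n LA LB : ℕ} (u : Fin (LB + LA) → QUnitary n) (r s : PauliLabel n)
    (B : QMat n) :
    ∑ γ : PauliPath n (LB + LA) with γ (Fin.last _) = r,
        pathWeight u γ * (if γ ⟨LB, by omega⟩ = s then trR (normPauli (γ 0)) B else 0) =
      trR ((circuitUnitary fun i => u (Fin.natAdd LB i) : QMat n).conjTranspose * normPauli r *
          (circuitUnitary fun i => u (Fin.natAdd LB i) : QMat n)) (normPauli s) *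
        trR ((circuitUnitary fun i => u (Fin.castAdd LA i) : QMat n).conjTranspose * normPauli s *
          (circuitUnitary fun i => u (Fin.castAdd LA i) : QMat n)) B := by
  induction LA generalizing r with
  | zero =>
    have h := sum_pathWeight u r B
    have hcut : ∀ γ : PauliPath n (LB + 0), γ ⟨LB, by omega⟩ = γ (Fin.last _) := fun γ => rfl
    simp only [hcut, circuitUnitary_of_isEmpty, OneMemClass.coe_one, Matrix.conjTranspose_one,
      one_mul, mul_one]
    by_cases hrs : r = s
    · subst hrs
      rw [trR_normPauli_self, one_mul]
      refine Eq.trans (Finset.sum_congr rfl fun γ hγ => ?_) h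
      rw [if_pos (Finset.mem_filter.mp hγ).2]
    · rw [trR_normPauli_of_ne hrs, zero_mul]
      refine Finset.sum_eq_zero fun γ hγ => ?_
      rw [(Finset.mem_filter.mp hγ).2, if_neg hrs, mul_zero]
  | succ LA ih =>
    have h := sum_pathWeight_succ (L := LB + LA) u r
      fun γ => if γ ⟨LB, by omega⟩ = s then trR (normPauli (γ 0)) B else 0
    simp only [ih, ← mul_assoc] at h
    rw [← Finset.sum_mul, sum_trR_mul_trR (conj_isHermitian (normPauli_isHermitian r) _)] at h
    refine h.trans ?_
    rw [circuitUnitary_succ fun i => u (Fin.natAdd LB i)]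
    simp only [Submonoid.coe_mul, Matrix.conjTranspose_mul, mul_assoc]
    rfl

/-! ### Path contributions to the output probability -/

/-- The contribution `Φ_γ(U) Tr[s_0 ρ]` of a Pauli path to the output probability. -/
noncomputable def pathTerm {n L : ℕ} (u : Fin L → QUnitary n) (γ : PauliPath n L) : ℝ :=
  fourierCoeff (zeroProj n) u γ * trR (normPauli (γ 0)) (zeroProj n)

lemma sum_pathTerm_last {n L : ℕ} (u : Fin L → QUnitary n) (r : PauliLabel n) :
    ∑ γ : PauliPath n L with γ (Fin.last _) = r, pathTerm u γ =
      trR (zeroProj n) (normPauli r) *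
        trR ((circuitUnitary u : QMat n).conjTranspose * normPauli r * (circuitUnitary u : QMat n))
          (zeroProj n) := by
  rw [← sum_pathWeight, Finset.mul_sum]
  refine Finset.sum_congr rfl fun γ hγ => ?_
  rw [pathTerm, fourierCoeff, (Finset.mem_filter.mp hγ).2, mul_assoc, pathWeight]

lemma sum_pathTerm_cut {n LA LB : ℕ} (u : Fin (LB + LA) → QUnitary n) (r s : PauliLabel n) :
    ∑ γ : PauliPath n (LB + LA) with (γ (Fin.last _), γ ⟨LB, by omega⟩) = (r, s), pathTerm u γ =
      trR (zeroProj n) (normPauli r) *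
        (trR ((circuitUnitary fun i => u (Fin.natAdd LB i) : QMat n).conjTranspose * normPauli r *
          (circuitUnitary fun i => u (Fin.natAdd LB i) : QMat n)) (normPauli s) *
        trR ((circuitUnitary fun i => u (Fin.castAdd LA i) : QMat n).conjTranspose * normPauli s *
          (circuitUnitary fun i => u (Fin.castAdd LA i) : QMat n)) (zeroProj n)) := by
  rw [← sum_pathWeight_cut, Finset.mul_sum, Finset.sum_filter, Finset.sum_filter]
  refine Finset.sum_congr rfl fun γ _ => ?_
  simp only [Prod.mk.injEq]
  by_cases h1 : γ (Fin.last _) = r <;> by_cases h2 : γ ⟨LB, by omega⟩ = s <;>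
    simp [h1, h2, pathTerm, fourierCoeff, mul_assoc, pathWeight]

lemma sum_pathTerm {n L : ℕ} (u : Fin L → QUnitary n) :
    ∑ γ : PauliPath n L, pathTerm u γ = expval (zeroProj n) (zeroProj n) u := by
  rw [← Finset.sum_fiberwise _ (fun γ : PauliPath n L => γ (Fin.last L))]
  simp only [sum_pathTerm_last]
  rw [sum_trR_mul_trR (zeroProj_isHermitian n), trR_conj_eq, trR_comm, expval]

lemma pathTerm_zero {n L : ℕ} (u : Fin L → QUnitary n) : pathTerm u 0 = 1 / 2 ^ n := by
  rw [pathTerm, fourierCoeff, ← trR_normPauli_zero_zeroProj_sq, trR_comm (zeroProj n)]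
  simp only [Pi.zero_apply]
  simp [conj_normPauli_zero, trR_normPauli_self]

lemma continuous_fourierCoeff {n L : ℕ} (O : QMat n) (γ : PauliPath n L) :
    Continuous fun u : Fin L → QUnitary n => fourierCoeff O u γ := by
  unfold fourierCoeff
  refine continuous_const.mul (continuous_finsetProd _ fun j _ => ?_)
  exact (continuous_trR_conj _ _).comp (continuous_apply j)

lemma continuous_pathTerm {n L : ℕ} (γ : PauliPath n L) :
    Continuous fun u : Fin L → QUnitary n => pathTerm u γ :=
  (continuous_fourierCoeff _ γ).mul continuous_const

lemma continuous_circuitUnitary {n L : ℕ} :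
    Continuous (circuitUnitary : (Fin L → QUnitary n) → QUnitary n) := by
  induction L with
  | zero => exact continuous_of_const fun u v => by simp [circuitUnitary_of_isEmpty]
  | succ L ih =>
    rw [funext circuitUnitary_succ]
    exact (continuous_apply _).mul (ih.comp (continuous_pi fun i => continuous_apply _))

section Orthogonality

variable {n L : ℕ} {μ : Measure (Fin L → QUnitary n)}

/-- The zero path has a constant, nonzero Fourier coefficient, so orthogonality to it is the
vanishing of the mean. -/
lemma integral_pathTerm_of_ne (h : HasOrthogonalPauliPaths (zeroProj n) μ) {γ : PauliPath n L}
    (hγ : γ ≠ 0) : ∫ u, pathTerm u γ ∂μ = 0 := by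
  have h0 : ∀ u, fourierCoeff (zeroProj n) u (0 : PauliPath n L) *
      trR (normPauli 0) (zeroProj n) = 1 / 2 ^ n := fun u => pathTerm_zero u
  have h1 : ∀ u : Fin L → QUnitary n, pathTerm u γ =
      (2 ^ n * trR (normPauli (γ 0)) (zeroProj n) * trR (normPauli 0) (zeroProj n)) *
        (fourierCoeff (zeroProj n) u γ * fourierCoeff (zeroProj n) u 0) := fun u => by
    rw [pathTerm, show ∀ a b c d e : ℝ, a * b * c * (d * e) = (d * b) * (a * (e * c)) by
      intros; ring, h0 u]
    field_simp
  simp only [h1]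
  rw [integral_const_mul, h γ 0 hγ, mul_zero]

lemma zero_mem_lowWeightPaths (n L k : ℕ) : (0 : PauliPath n L) ∈ lowWeightPaths n L k := by
  simp [lowWeightPaths, weight]

lemma sum_erase_zero_pathTerm (u : Fin L → QUnitary n) {S : Finset (PauliPath n L)}
    (hS : 0 ∈ S) : ∑ γ ∈ S.erase 0, pathTerm u γ = ∑ γ ∈ S, pathTerm u γ - 1 / 2 ^ n := by
  rw [← Finset.add_sum_erase _ _ hS, pathTerm_zero]
  ring

variable [IsProbabilityMeasure μ]

lemma integral_sum_pathTerm_sq (h : HasOrthogonalPauliPaths (zeroProj n) μ)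
    (S : Finset (PauliPath n L)) :
    ∫ u, (∑ γ ∈ S, pathTerm u γ) ^ 2 ∂μ = ∑ γ ∈ S, ∫ u, pathTerm u γ ^ 2 ∂μ := by
  have hi : ∀ γ γ' : PauliPath n L, Integrable (fun u => pathTerm u γ * pathTerm u γ') μ :=
    fun γ γ' => integrable_of_continuous ((continuous_pathTerm γ).mul (continuous_pathTerm γ'))
  have h2 : ∀ u, (∑ γ ∈ S, pathTerm u γ) ^ 2 = ∑ γ ∈ S, ∑ γ' ∈ S, pathTerm u γ * pathTerm u γ' :=
    fun u => by rw [sq, Finset.sum_mul_sum]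
  simp only [h2]
  rw [integral_finsetSum _ fun γ _ => integrable_finsetSum _ fun γ' _ => hi γ γ']
  refine Finset.sum_congr rfl fun γ hγ => ?_
  rw [integral_finsetSum _ fun γ' _ => hi γ γ', Finset.sum_eq_single γ]
  · simp only [sq]
  · intro γ' _ hne
    have h1 : ∀ u, pathTerm u γ * pathTerm u γ' =
        (trR (normPauli (γ 0)) (zeroProj n) * trR (normPauli (γ' 0)) (zeroProj n)) *
          (fourierCoeff (zeroProj n) u γ * fourierCoeff (zeroProj n) u γ') := fun u => by
      rw [pathTerm, pathTerm]; ring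
    simp only [h1]
    rw [integral_const_mul, h γ γ' hne.symm, mul_zero]
  · exact fun hc => absurd hγ hc

lemma variance_lowWeightEstimator (h : HasOrthogonalPauliPaths (zeroProj n) μ) (k : ℕ) :
    variance (lowWeightEstimator k (zeroProj n) (zeroProj n)) μ =
      ∑ γ ∈ (lowWeightPaths n L k).erase 0, ∫ u, pathTerm u γ ^ 2 ∂μ := by
  have he : lowWeightEstimator k (zeroProj n) (zeroProj n) =
      fun u : Fin L → QUnitary n => ∑ γ ∈ lowWeightPaths n L k, pathTerm u γ := rfl
  have hc : Continuous fun u : Fin L → QUnitary n => ∑ γ ∈ lowWeightPaths n L k, pathTerm u γ :=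
    continuous_finsetSum _ fun γ _ => continuous_pathTerm γ
  have hmean : ∫ u, ∑ γ ∈ lowWeightPaths n L k, pathTerm u γ ∂μ = 1 / 2 ^ n := by
    rw [integral_finsetSum _ fun γ _ => integrable_of_continuous (continuous_pathTerm γ),
      Finset.sum_eq_single 0]
    · simp [pathTerm_zero]
    · exact fun γ _ hγ => integral_pathTerm_of_ne h hγ
    · exact fun hc => absurd (zero_mem_lowWeightPaths n L k) hc
  rw [he, variance_eq_integral hc.aemeasurable, hmean, ← integral_sum_pathTerm_sq h]
  simp only [sum_erase_zero_pathTerm _ (zero_mem_lowWeightPaths n L k)]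

/-- The XQUATH score of low-weight Pauli propagation is its variance. -/
lemma XQ_lowWeightEstimator (h : HasOrthogonalPauliPaths (zeroProj n) μ) (k : ℕ) :
    XQ μ (lowWeightEstimator k (zeroProj n) (zeroProj n)) =
      variance (lowWeightEstimator k (zeroProj n) (zeroProj n)) μ := by
  rw [variance_lowWeightEstimator h, XQ]
  have h1 : ∀ u : Fin L → QUnitary n, expval (zeroProj n) (zeroProj n) u - 1 / 2 ^ n =
      ∑ γ ∈ Finset.univ.erase 0, pathTerm u γ := fun u => by
    rw [sum_erase_zero_pathTerm u (Finset.mem_univ _), sum_pathTerm]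
  have h2 : ∀ u : Fin L → QUnitary n, expval (zeroProj n) (zeroProj n) u -
      lowWeightEstimator k (zeroProj n) (zeroProj n) u =
      ∑ γ ∈ Finset.univ \ lowWeightPaths n L k, pathTerm u γ := fun u => by
    rw [← sum_pathTerm, ← Finset.sum_sdiff (Finset.subset_univ (lowWeightPaths n L k)),
      add_sub_assoc, add_eq_left, sub_eq_zero]
    rfl
  simp only [h1, h2, integral_sum_pathTerm_sq h]
  have h3 := Finset.sum_sdiff (f := fun γ => ∫ u, pathTerm u γ ^ 2 ∂μ)
    (Finset.subset_univ (lowWeightPaths n L k))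
  have h4 := Finset.add_sum_erase (f := fun γ => ∫ u, pathTerm u γ ^ 2 ∂μ) _
    (Finset.mem_univ (0 : PauliPath n L))
  have h5 := Finset.add_sum_erase (f := fun γ => ∫ u, pathTerm u γ ^ 2 ∂μ) _
    (zero_mem_lowWeightPaths n L k)
  linarith

/-- Grouping the paths by the value of `κ` bounds the variance by the second moments of the
groups. -/
lemma variance_lowWeightEstimator_le {K : Type*} [DecidableEq K]
    (h : HasOrthogonalPauliPaths (zeroProj n) μ) (k : ℕ) (κ : PauliPath n L → K) (T : Finset K)
    (hT : ∀ γ ∈ lowWeightPaths n L k, κ γ ∈ T)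
    (h0 : ∀ u, ∑ γ : PauliPath n L with κ γ = κ 0, pathTerm u γ = 1 / 2 ^ n) :
    variance (lowWeightEstimator k (zeroProj n) (zeroProj n)) μ ≤
      ∑ q ∈ T.erase (κ 0), ∫ u, (∑ γ : PauliPath n L with κ γ = q, pathTerm u γ) ^ 2 ∂μ := by
  have h0T := hT 0 (zero_mem_lowWeightPaths n L k)
  -- Orthogonality is used in reverse here: the second moment of a whole group is the sum over all
  -- its paths and dominates the sum over the retained ones. The group of the zero path equals
  -- `2⁻ⁿ`, just like the zero path alone, so the two cancel afterwards.
  have h1 : ∑ γ ∈ lowWeightPaths n L k, ∫ u, pathTerm u γ ^ 2 ∂μ ≤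
      ∑ q ∈ T, ∫ u, (∑ γ : PauliPath n L with κ γ = q, pathTerm u γ) ^ 2 ∂μ := by
    rw [← Finset.sum_fiberwise_of_maps_to hT]
    refine Finset.sum_le_sum fun q _ => ?_
    rw [integral_sum_pathTerm_sq h]
    exact Finset.sum_le_sum_of_subset_of_nonneg
      (Finset.filter_subset_filter _ (Finset.subset_univ _))
      fun _ _ _ => integral_nonneg fun _ => sq_nonneg _
  rw [← Finset.add_sum_erase _ _ h0T, ← Finset.add_sum_erase _ _ (zero_mem_lowWeightPaths n L k)]
    at h1
  simp only [h0, pathTerm_zero] at h1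
  rw [variance_lowWeightEstimator h]
  linarith

end Orthogonality

/-! ### Counting low-weight Pauli strings -/

/-- The non-identity Pauli strings of weight at most `k`. -/
def lowLabels (n k : ℕ) : Finset (PauliLabel n) :=
  Finset.univ.filter fun s => s ≠ 0 ∧ weight s ≤ k

lemma card_lowLabels_le_four_pow (n k : ℕ) : ((lowLabels n k).card : ℝ) ≤ 4 ^ n := by
  have h := Finset.card_le_univ (lowLabels n k)
  simp only [Fintype.card_pi, Fintype.card_fin, Finset.prod_const, Finset.card_univ] at h
  exact_mod_cast h

lemma lowLabels_zero (k : ℕ) : lowLabels 0 k = ∅ := by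
  simp only [lowLabels, Finset.filter_eq_empty_iff, Finset.mem_univ, true_imp_iff, not_and]
  exact fun s hs => absurd (Subsingleton.elim s 0) hs

lemma sum_pow_weight (n : ℕ) (x : ℝ) : ∑ s : PauliLabel n, x ^ weight s = (1 + 3 * x) ^ n := by
  have h1 : ∀ s : PauliLabel n, x ^ weight s = ∏ i, if s i ≠ 0 then x else 1 := fun s => by
    rw [Finset.prod_ite, Finset.prod_const, Finset.prod_const_one, mul_one, weight]
  have h2 := Finset.prod_univ_sum (fun _ : Fin n => (Finset.univ : Finset (Fin 4)))
    (fun _ a => if a ≠ 0 then x else 1)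
  rw [Fintype.piFinset_univ] at h2
  simp only [h1]
  rw [← h2, Finset.prod_const, Finset.card_univ, Fintype.card_fin]
  congr 1
  simp [Fin.sum_univ_four]
  ring

/-- Evaluate the weight generating function `(1 + 3x)ⁿ` at `x = 1/n`: each counted string
contributes at least `n⁻ᵏ`, and the total is at most `e³`. -/
lemma card_lowLabels_le (n k : ℕ) : ((lowLabels n k).card : ℝ) ≤ Real.exp 3 * (n : ℝ) ^ k := by
  rcases Nat.eq_zero_or_pos n with rfl | hn
  · rw [lowLabels_zero, Finset.card_empty, Nat.cast_zero]
    positivity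
  · have hn' : (1 : ℝ) ≤ n := by exact_mod_cast hn
    have hx : (1 : ℝ) / n ≤ 1 := by rw [div_le_one (by linarith)]; exact hn'
    have h1 : ∑ _s ∈ lowLabels n k, (1 / (n : ℝ)) ^ k ≤ (1 + 3 * (1 / (n : ℝ))) ^ n := by
      rw [← sum_pow_weight]
      refine (Finset.sum_le_sum fun s hs => ?_).trans
        (Finset.sum_le_sum_of_subset_of_nonneg (Finset.subset_univ _) fun _ _ _ => by positivity)
      exact pow_le_pow_of_le_one (by positivity) hx (Finset.mem_filter.mp hs).2.2
    have h2 : (1 + 3 * (1 / (n : ℝ))) ^ n ≤ Real.exp 3 := by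
      have : 1 + 3 * (1 / (n : ℝ)) ≤ Real.exp (3 / n) := by
        have := Real.add_one_le_exp (3 / (n : ℝ))
        linarith [show 3 * (1 / (n : ℝ)) = 3 / n by ring]
      refine (pow_le_pow_left₀ (by positivity) this n).trans (le_of_eq ?_)
      rw [← Real.exp_nat_mul]
      congr 1
      field_simp
    rw [Finset.sum_const, nsmul_eq_mul, one_div_pow, mul_one_div] at h1
    exact (div_le_iff₀ (by positivity)).mp (h1.trans h2)

/-! ### Variance bounds -/

lemma continuous_append {n LA LB : ℕ} :
    Continuous fun p : (Fin LA → QUnitary n) × (Fin LB → QUnitary n) => Fin.append p.2 p.1 := by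
  refine continuous_pi fun i => ?_
  refine Fin.addCases (fun j => ?_) (fun j => ?_) i
  · simp only [Fin.append_left]
    exact (continuous_apply j).comp continuous_snd
  · simp only [Fin.append_right]
    exact (continuous_apply j).comp continuous_fst

/-- The second moment `E_U (Tr[U† A U B])²`. -/
noncomputable def conjMoment {n : ℕ} (D : Measure (QUnitary n)) (A B : QMat n) : ℝ :=
  ∫ U : QUnitary n, trR ((U : QMat n).conjTranspose * A * (U : QMat n)) B ^ 2 ∂D

lemma conjMoment_nonneg {n : ℕ} (D : Measure (QUnitary n)) (A B : QMat n) :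
    0 ≤ conjMoment D A B := integral_nonneg fun _ => sq_nonneg _

lemma sum_conjMoment {n : ℕ} (D : Measure (QUnitary n)) [IsProbabilityMeasure D] {A : QMat n}
    (hA : A.IsHermitian) : ∑ s, conjMoment D A (normPauli s) = trR A A := by
  simp only [conjMoment]
  rw [← integral_finsetSum]
  · simp [sum_trR_sq (conj_isHermitian hA _), trR_conj_self]
  · exact fun s _ => integrable_of_continuous ((continuous_trR_conj _ _).pow 2)

lemma conjMoment_map {n L : ℕ} (μ : Measure (Fin L → QUnitary n)) (A B : QMat n) :
    conjMoment (μ.map circuitUnitary) A B =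
      ∫ u, trR ((circuitUnitary u : QMat n).conjTranspose * A * (circuitUnitary u : QMat n)) B ^ 2
        ∂μ :=
  integral_map continuous_circuitUnitary.aemeasurable
    ((continuous_trR_conj A B).pow 2).aestronglyMeasurable

instance isProbabilityMeasure_map_circuitUnitary {n L : ℕ} (μ : Measure (Fin L → QUnitary n))
    [IsProbabilityMeasure μ] : IsProbabilityMeasure (μ.map circuitUnitary) :=
  Measure.isProbabilityMeasure_map continuous_circuitUnitary.aemeasurable

instance isProbabilityMeasure_composeLaw {n LA LB : ℕ} (μA : Measure (Fin LA → QUnitary n))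
    (μB : Measure (Fin LB → QUnitary n)) [IsProbabilityMeasure μA] [IsProbabilityMeasure μB] :
    IsProbabilityMeasure (composeLaw μA μB) :=
  Measure.isProbabilityMeasure_map continuous_append.aemeasurable

lemma integral_sum_pathTerm_cut_sq {n LA LB : ℕ} (μA : Measure (Fin LA → QUnitary n))
    (μB : Measure (Fin LB → QUnitary n)) [IsProbabilityMeasure μA] [IsProbabilityMeasure μB]
    (r s : PauliLabel n) :
    ∫ u, (∑ γ : PauliPath n (LB + LA) with (γ (Fin.last _), γ ⟨LB, by omega⟩) = (r, s),
        pathTerm u γ) ^ 2 ∂composeLaw μA μB =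
      trR (zeroProj n) (normPauli r) ^ 2 *
        (conjMoment (μA.map circuitUnitary) (normPauli r) (normPauli s) *
          conjMoment (μB.map circuitUnitary) (normPauli s) (zeroProj n)) := by
  have hc : Continuous fun u : Fin (LB + LA) → QUnitary n => (∑ γ : PauliPath n (LB + LA)
      with (γ (Fin.last _), γ ⟨LB, by omega⟩) = (r, s), pathTerm u γ) ^ 2 :=
    (continuous_finsetSum _ fun γ _ => continuous_pathTerm γ).pow 2
  rw [composeLaw, integral_map continuous_append.aemeasurable hc.aestronglyMeasurable,
    conjMoment_map, conjMoment_map, ← integral_prod_mul, ← integral_const_mul]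
  refine integral_congr_ae (ae_of_all _ fun p => ?_)
  simp only [sum_pathTerm_cut, Fin.append_left, Fin.append_right]
  ring

/-- Positivity of `LB` matters: it keeps the cut away from index 0, the one label that the
truncation leaves unconstrained. -/
lemma variance_le_sum_conjMoment {n LA LB : ℕ} (hLB : 0 < LB) (μA : Measure (Fin LA → QUnitary n))
    (μB : Measure (Fin LB → QUnitary n)) [IsProbabilityMeasure μA] [IsProbabilityMeasure μB]
    (h : HasOrthogonalPauliPaths (zeroProj n) (composeLaw μA μB)) (k : ℕ) :
    variance (lowWeightEstimator k (zeroProj n) (zeroProj n)) (composeLaw μA μB) ≤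
      ∑ r ∈ lowLabels n k, ∑ s ∈ lowLabels n k, 1 / 2 ^ n *
        (conjMoment (μA.map circuitUnitary) (normPauli r) (normPauli s) *
          conjMoment (μB.map circuitUnitary) (normPauli s) (zeroProj n)) := by
  have h1 := variance_lowWeightEstimator_le h k
    (fun γ => (γ (Fin.last _), γ ⟨LB, by omega⟩))
    ((Finset.univ.filter fun s => weight s ≤ k) ×ˢ (Finset.univ.filter fun s => weight s ≤ k))
    (fun γ hγ => by
      have hγ' := (Finset.mem_filter.mp hγ).2
      simp only [Finset.mem_product, Finset.mem_filter, Finset.mem_univ, true_and]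
      exact ⟨hγ' _ (Fin.ne_of_val_ne (by simp; omega)), hγ' _ (Fin.ne_of_val_ne (by simp; omega))⟩)
    (fun u => by
      simp only [Pi.zero_apply]
      rw [sum_pathTerm_cut, conj_normPauli_zero, conj_normPauli_zero, trR_normPauli_self, one_mul,
        trR_comm (zeroProj n), trR_normPauli_zero_zeroProj_sq])
  refine h1.trans ?_
  rw [← Finset.sum_product']
  simp only [Pi.zero_apply]
  rw [← Finset.sum_subset (s₁ := lowLabels n k ×ˢ lowLabels n k)]
  · refine Finset.sum_le_sum fun q _ => ?_
    rw [integral_sum_pathTerm_cut_sq]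
    exact mul_le_mul_of_nonneg_right (trR_zeroProj_normPauli_sq_le _)
      (mul_nonneg (conjMoment_nonneg _ _ _) (conjMoment_nonneg _ _ _))
  · intro q hq
    simp only [lowLabels, Finset.mem_product, Finset.mem_filter, Finset.mem_univ, true_and] at hq
    simp only [Finset.mem_erase, Finset.mem_product, Finset.mem_filter, Finset.mem_univ, true_and]
    exact ⟨fun hc => hq.1.1 (congrArg Prod.fst hc), hq.1.2, hq.2.2⟩
  · rintro ⟨r, s⟩ hq hq'
    rw [integral_sum_pathTerm_cut_sq]
    simp only [lowLabels, Finset.mem_product, Finset.mem_filter, Finset.mem_univ, true_and,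
      Finset.mem_erase, ne_eq, Prod.mk.injEq] at hq hq'
    -- A pair with exactly one identity string has zero transition amplitude.
    have h0 : conjMoment (μA.map circuitUnitary) (normPauli r) (normPauli s) = 0 := by
      by_cases hr : r = 0
      · subst hr
        have hs : s ≠ 0 := fun hs => hq.1 ⟨rfl, hs⟩
        simp [conjMoment, trR_conj_zero_left _ hs]
      · have hs : s = 0 := by
          by_contra hs
          exact hq' ⟨⟨hr, hq.2.1⟩, hs, hq.2.2⟩
        subst hs
        simp [conjMoment, trR_conj_zero_right _ hr]
    rw [h0, zero_mul, mul_zero]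

/-- A cruder bound that groups by the output label only; it serves the case where the first-acting
circuit has no layers. -/
lemma variance_le_card_lowLabels {n L : ℕ} (hL : 0 < L) (μ : Measure (Fin L → QUnitary n))
    [IsProbabilityMeasure μ] (h : HasOrthogonalPauliPaths (zeroProj n) μ) (k : ℕ) :
    variance (lowWeightEstimator k (zeroProj n) (zeroProj n)) μ ≤
      (lowLabels n k).card / 4 ^ n := by
  have h1 := variance_lowWeightEstimator_le h k
    (fun γ => γ (Fin.last _)) (Finset.univ.filter fun s => weight s ≤ k)
    (fun γ hγ => by
      have hγ' := (Finset.mem_filter.mp hγ).2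
      simp only [Finset.mem_filter, Finset.mem_univ, true_and]
      exact hγ' _ (Fin.ne_of_val_ne (by simp; omega)))
    (fun u => by
      simp only [Pi.zero_apply]
      rw [sum_pathTerm_last, conj_normPauli_zero, trR_comm (zeroProj n),
        trR_normPauli_zero_zeroProj_sq])
  refine h1.trans ?_
  have he : (Finset.univ.filter fun s : PauliLabel n => weight s ≤ k).erase 0 = lowLabels n k := by
    ext s
    simp [lowLabels]
  simp only [Pi.zero_apply]
  rw [he, div_eq_mul_one_div, ← nsmul_eq_mul]
  refine Finset.sum_le_card_nsmul _ _ _ fun r _ => ?_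
  have h2 : ∀ u : Fin L → QUnitary n,
      (∑ γ : PauliPath n L with γ (Fin.last _) = r, pathTerm u γ) ^ 2 ≤ 1 / 4 ^ n := fun u => by
    rw [sum_pathTerm_last, mul_pow, show (1 : ℝ) / 4 ^ n = 1 / 2 ^ n * (1 / 2 ^ n) by
      rw [show (4 : ℝ) = 2 * 2 by norm_num, mul_pow]; field_simp]
    exact mul_le_mul (trR_zeroProj_normPauli_sq_le _) (trR_conj_zeroProj_sq_le _ _)
      (sq_nonneg _) (by positivity)
  refine (integral_mono (integrable_of_continuous
    ((continuous_finsetSum _ fun γ _ => continuous_pathTerm γ).pow 2)) (integrable_const _)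
    h2).trans (le_of_eq ?_)
  simp

/-- A circuit without layers is not a good approximate 2-design. -/
lemma half_le_of_isApproxTwoDesign_of_isEmpty {n : ℕ} (hn : 2 ≤ n)
    (μ : Measure (Fin 0 → QUnitary n)) [IsProbabilityMeasure μ] {ε : ℝ}
    (h : IsApproxTwoDesign (μ.map circuitUnitary) ε) : 1 / 2 ≤ ε := by
  -- The test string is `Z⊗ⁿ`: with no layers its moment is exactly `2⁻ⁿ`, far above the Haar value
  -- of order `4⁻ⁿ`.
  have hs : (fun _ => 3 : PauliLabel n) ≠ 0 := fun hc => by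
    have := congrFun hc ⟨0, by omega⟩
    simp at this
  have h1 : conjMoment (μ.map circuitUnitary) (normPauli fun _ => 3) (zeroProj n) ≤
    2 / 4 ^ n + ε / 2 ^ n := h.moment_zeroProj_le hs
  have h2 : conjMoment (μ.map circuitUnitary) (normPauli fun _ => 3) (zeroProj n) = 1 / 2 ^ n := by
    rw [conjMoment_map]
    simp only [circuitUnitary_of_isEmpty, OneMemClass.coe_one, Matrix.conjTranspose_one, one_mul,
      mul_one, integral_const, probReal_univ, smul_eq_mul]
    rw [trR_zeroProj]
    simp only [normPauli, Matrix.of_apply, pauli, Pi.zero_apply, Finset.prod_const,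
      Finset.card_univ, Fintype.card_fin]
    have : (((Real.sqrt 2)⁻¹ : ℝ) : ℂ) * (![1, !![0, 1; 1, 0], !![0, -Complex.I; Complex.I, 0],
      !![1, 0; 0, -1]] : Fin 4 → Matrix (Fin 2) (Fin 2) ℂ) 3 0 0 = (((Real.sqrt 2)⁻¹ : ℝ) : ℂ) := by
      simp
    rw [this, ← Complex.ofReal_pow, Complex.ofReal_re, ← pow_mul, mul_comm n 2, pow_mul, inv_pow,
      Real.sq_sqrt (by norm_num), inv_pow, one_div]
  rw [h2] at h1
  have h4 : (4 : ℝ) ≤ 2 ^ n := by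
    calc (4 : ℝ) = 2 ^ 2 := by norm_num
      _ ≤ 2 ^ n := pow_le_pow_right₀ (by norm_num) hn
  rw [show (4 : ℝ) ^ n = 2 ^ n * 2 ^ n by rw [← mul_pow]; norm_num] at h1
  field_simp at h1
  nlinarith

/-! ### Bounds for compositions of approximate 2-designs -/

section Compose

variable {n LA LB : ℕ} {μA : Measure (Fin LA → QUnitary n)} {μB : Measure (Fin LB → QUnitary n)}
  [IsProbabilityMeasure μA] [IsProbabilityMeasure μB] {ε : ℝ}

lemma variance_le_of_isApproxTwoDesign (hLB : 0 < LB)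
    (hA : IsApproxTwoDesign (μA.map circuitUnitary) ε)
    (hB : IsApproxTwoDesign (μB.map circuitUnitary) ε)
    (h : HasOrthogonalPauliPaths (zeroProj n) (composeLaw μA μB)) (k : ℕ) :
    variance (lowWeightEstimator k (zeroProj n) (zeroProj n)) (composeLaw μA μB) ≤
      (lowLabels n k).card ^ 2 * (1 / 2 ^ n * ((2 / 4 ^ n + ε) * (2 / 4 ^ n + ε / 2 ^ n))) := by
  have hε := hA.nonneg
  refine (variance_le_sum_conjMoment hLB μA μB h k).trans ?_
  rw [sq, mul_assoc, ← nsmul_eq_mul, ← nsmul_eq_mul]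
  refine Finset.sum_le_card_nsmul _ _ _ fun r hr => Finset.sum_le_card_nsmul _ _ _ fun s hs => ?_
  refine mul_le_mul_of_nonneg_left (mul_le_mul ?_ ?_ (conjMoment_nonneg _ _ _) (by positivity))
    (by positivity)
  · exact hA.moment_normPauli_le (Finset.mem_filter.mp hr).2.1 (Finset.mem_filter.mp hs).2.1
  · exact hB.moment_zeroProj_le (Finset.mem_filter.mp hs).2.1

/-- The row sum of the first circuit's moments is bounded twice: by the design estimate where it
multiplies `2/4ⁿ`, and by 1 through Parseval where it multiplies `ε/2ⁿ`. With at most `4ⁿ` labels in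
all, the `ε` terms then carry a single factor of the label count. -/
lemma variance_le_of_isApproxTwoDesign' (hLB : 0 < LB)
    (hA : IsApproxTwoDesign (μA.map circuitUnitary) ε)
    (hB : IsApproxTwoDesign (μB.map circuitUnitary) ε)
    (h : HasOrthogonalPauliPaths (zeroProj n) (composeLaw μA μB)) (k : ℕ) :
    variance (lowWeightEstimator k (zeroProj n) (zeroProj n)) (composeLaw μA μB) ≤
      4 * (lowLabels n k).card ^ 2 / 2 ^ (5 * n) + 3 * ε * (lowLabels n k).card / 2 ^ n := by
  have hε := hA.nonneg
  set N : ℝ := ((lowLabels n k).card : ℝ) with hN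
  have hN4 : N ≤ 4 ^ n := card_lowLabels_le_four_pow n k
  have hN0 : 0 ≤ N := Nat.cast_nonneg _
  have hrow : ∀ r ∈ lowLabels n k, ∑ s ∈ lowLabels n k, 1 / 2 ^ n *
        (conjMoment (μA.map circuitUnitary) (normPauli r) (normPauli s) *
          conjMoment (μB.map circuitUnitary) (normPauli s) (zeroProj n)) ≤
      1 / 2 ^ n * (2 / 4 ^ n * (N * (2 / 4 ^ n + ε)) + ε / 2 ^ n) := by
    intro r hr
    rw [← Finset.mul_sum]
    refine mul_le_mul_of_nonneg_left ?_ (by positivity)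
    have h1 : ∑ s ∈ lowLabels n k, conjMoment (μA.map circuitUnitary) (normPauli r) (normPauli s)
        ≤ N * (2 / 4 ^ n + ε) := by
      rw [hN, ← nsmul_eq_mul]
      exact Finset.sum_le_card_nsmul _ _ _ fun s hs =>
        hA.moment_normPauli_le (Finset.mem_filter.mp hr).2.1 (Finset.mem_filter.mp hs).2.1
    have h2 : ∑ s ∈ lowLabels n k, conjMoment (μA.map circuitUnitary) (normPauli r) (normPauli s)
        ≤ 1 := by
      rw [← trR_normPauli_self r,
        ← sum_conjMoment (μA.map circuitUnitary) (normPauli_isHermitian r)]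
      exact Finset.sum_le_sum_of_subset_of_nonneg (Finset.subset_univ _)
        fun _ _ _ => conjMoment_nonneg _ _ _
    calc _ ≤ ∑ s ∈ lowLabels n k, conjMoment (μA.map circuitUnitary) (normPauli r) (normPauli s) *
          (2 / 4 ^ n + ε / 2 ^ n) := Finset.sum_le_sum fun s hs =>
            mul_le_mul_of_nonneg_left (hB.moment_zeroProj_le (Finset.mem_filter.mp hs).2.1)
              (conjMoment_nonneg _ _ _)
      _ = 2 / 4 ^ n * (∑ s ∈ lowLabels n k,
            conjMoment (μA.map circuitUnitary) (normPauli r) (normPauli s)) + ε / 2 ^ n *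
          (∑ s ∈ lowLabels n k,
            conjMoment (μA.map circuitUnitary) (normPauli r) (normPauli s)) := by
        rw [← Finset.sum_mul]; ring
      _ ≤ 2 / 4 ^ n * (N * (2 / 4 ^ n + ε)) + ε / 2 ^ n * 1 := by gcongr
      _ = _ := by rw [mul_one]
  refine (variance_le_sum_conjMoment hLB μA μB h k).trans
    ((Finset.sum_le_card_nsmul _ _ _ hrow).trans ?_)
  rw [nsmul_eq_mul, ← hN]
  have h2 : (1 : ℝ) ≤ 2 ^ n := one_le_pow₀ (by norm_num)
  have h3 : N / 4 ^ n ≤ 1 := by rw [div_le_one (by positivity)]; exact hN4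
  have h4 : ε / 2 ^ n ≤ ε := div_le_self hε h2
  calc N * (1 / 2 ^ n * (2 / 4 ^ n * (N * (2 / 4 ^ n + ε)) + ε / 2 ^ n))
      = 4 * N ^ 2 * (1 / 2 ^ n * (1 / 4 ^ n * (1 / 4 ^ n))) +
        (N / 2 ^ n) * (2 * ε * (N / 4 ^ n) + ε / 2 ^ n) := by ring
    _ ≤ 4 * N ^ 2 * (1 / 2 ^ n * (1 / 4 ^ n * (1 / 4 ^ n))) +
        (N / 2 ^ n) * (2 * ε * 1 + ε) := by gcongr
    _ = 4 * N ^ 2 / 2 ^ (5 * n) + 3 * ε * N / 2 ^ n := by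
      have : (2 : ℝ) ^ (5 * n) = 2 ^ n * (4 ^ n * 4 ^ n) := by
        rw [pow_mul, ← mul_pow, ← mul_pow]; norm_num
      rw [this]
      field_simp
      ring

lemma variance_le_exp (hA : IsApproxTwoDesign (μA.map circuitUnitary) ε)
    (hB : IsApproxTwoDesign (μB.map circuitUnitary) ε)
    (h : HasOrthogonalPauliPaths (zeroProj n) (composeLaw μA μB)) (k : ℕ) :
    variance (lowWeightEstimator k (zeroProj n) (zeroProj n)) (composeLaw μA μB) ≤
      32 * Real.exp 3 ^ 2 * ((n : ℝ) ^ (4 * k) / 2 ^ (5 * n)) +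
        32 * Real.exp 3 ^ 2 * (ε * (n : ℝ) ^ k / 2 ^ n) := by
  have hε := hA.nonneg
  have hK : 1 ≤ Real.exp 3 := Real.one_le_exp (by norm_num)
  have hN := card_lowLabels_le n k
  have hN0 : (0 : ℝ) ≤ (lowLabels n k).card := Nat.cast_nonneg _
  set K := Real.exp 3
  rcases Nat.eq_zero_or_pos LB with rfl | hLB
  · rcases Nat.eq_zero_or_pos LA with rfl | hLA
    -- There is only one circuit without layers, so the estimator is constant.
    · have hc : (lowWeightEstimator k (zeroProj n) (zeroProj n) : (Fin (0 + 0) → QUnitary n) → ℝ) =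
          fun _ => lowWeightEstimator k (zeroProj n) (zeroProj n) (fun i => Fin.elim0 i) :=
        funext fun u => congrArg _ (funext fun i => Fin.elim0 i)
      rw [hc, variance_eq_integral aemeasurable_const]
      simp only [integral_const, probReal_univ, one_smul, sub_self, ne_eq, OfNat.ofNat_ne_zero,
        not_false_eq_true, zero_pow, smul_zero]
      positivity
    · have h1 := variance_le_card_lowLabels (by omega) _ h k
      refine h1.trans ?_
      have hcases : n = 0 ∨ n = 1 ∨ 2 ≤ n := by omega
      rcases hcases with rfl | rfl | hn
      · rw [lowLabels_zero]
        simp only [Finset.card_empty, Nat.cast_zero, zero_div]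
        positivity
      -- On one qubit the variance is at most 1, and the constant 32 cancels `2⁵` in the first term
      -- of the bound.
      · have h2 := card_lowLabels_le_four_pow 1 k
        have h3 : (0 : ℝ) ≤ 32 * K ^ 2 * (ε * ((1 : ℕ) : ℝ) ^ k / 2 ^ 1) := by positivity
        have h4 : 1 ≤ K ^ 2 := one_le_pow₀ hK
        have h5 : 32 * K ^ 2 * (((1 : ℕ) : ℝ) ^ (4 * k) / 2 ^ (5 * 1)) = K ^ 2 := by
          rw [Nat.cast_one, one_pow]; ring
        rw [h5]
        have h6 : ((lowLabels 1 k).card : ℝ) / 4 ^ 1 ≤ 1 := by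
          rw [div_le_one (by positivity)]; exact h2
        linarith
      -- An empty circuit forces `ε ≥ 1/2`, so the term with `ε` alone absorbs the crude bound.
      · have h2 := half_le_of_isApproxTwoDesign_of_isEmpty hn μB hB
        have h3 : (2 : ℝ) ^ n ≤ 4 ^ n := pow_le_pow_left₀ (by norm_num) (by norm_num) n
        have h0 : (0 : ℝ) ≤ 32 * K ^ 2 * ((n : ℝ) ^ (4 * k) / 2 ^ (5 * n)) := by positivity
        calc ((lowLabels n k).card : ℝ) / 4 ^ n ≤ K * (n : ℝ) ^ k / 2 ^ n := by gcongr
          _ = K * 1 * (n : ℝ) ^ k / 2 ^ n := by ring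
          _ ≤ K * (2 * ε) * (n : ℝ) ^ k / 2 ^ n := by gcongr; linarith
          _ ≤ K * (K * 32 * ε) * (n : ℝ) ^ k / 2 ^ n := by gcongr; linarith
          _ = 32 * K ^ 2 * (ε * (n : ℝ) ^ k / 2 ^ n) := by ring
          _ ≤ _ := le_add_of_nonneg_left h0
  · refine (variance_le_of_isApproxTwoDesign' hLB hA hB h k).trans ?_
    -- The argument yields `n^{2k}`; the stated exponent `4k` is slack. Working in the naturals
    -- covers `n = 0`, where `nᵏ` may vanish.
    have h4 : ((n : ℝ) ^ k) ^ 2 ≤ (n : ℝ) ^ (4 * k) := by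
      rw [mul_comm 4 k, pow_mul]
      have : (n ^ k) ^ 2 ≤ (n ^ k) ^ 4 := by
        rcases Nat.eq_zero_or_pos (n ^ k) with h0 | h0
        · simp [h0]
        · exact Nat.pow_le_pow_right h0 (by norm_num)
      exact_mod_cast this
    calc 4 * ((lowLabels n k).card : ℝ) ^ 2 / 2 ^ (5 * n) +
          3 * ε * (lowLabels n k).card / 2 ^ n
        ≤ 4 * (K * (n : ℝ) ^ k) ^ 2 / 2 ^ (5 * n) + 3 * ε * (K * (n : ℝ) ^ k) / 2 ^ n := by gcongr
      _ = 4 * K ^ 2 * (((n : ℝ) ^ k) ^ 2 / 2 ^ (5 * n)) + 3 * K * (ε * (n : ℝ) ^ k / 2 ^ n) := by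
        ring
      _ ≤ _ := by
        gcongr
        · norm_num
        · norm_num
        · exact le_self_pow₀ hK two_ne_zero

lemma variance_le_of_small_error (hn : 2 ≤ n) {k : ℕ} (hε : ε ≤ 1 / (2 ^ n * (n : ℝ) ^ k))
    (hA : IsApproxTwoDesign (μA.map circuitUnitary) ε)
    (hB : IsApproxTwoDesign (μB.map circuitUnitary) ε)
    (h : HasOrthogonalPauliPaths (zeroProj n) (composeLaw μA μB)) :
    variance (lowWeightEstimator k (zeroProj n) (zeroProj n)) (composeLaw μA μB) ≤
      9 * Real.exp 3 ^ 2 * ((n : ℝ) ^ (2 * k) / 2 ^ n * (1 / 2 ^ (3 * n))) := by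
  have hε0 := hA.nonneg
  have hn1 : (1 : ℝ) ≤ n := by exact_mod_cast (by omega : 1 ≤ n)
  have hε1 : ε ≤ 1 / 2 ^ n := hε.trans <| by
    gcongr
    exact le_mul_of_one_le_right (by positivity) (one_le_pow₀ hn1)
  have h4 : (4 : ℝ) ≤ 2 ^ n := by
    calc (4 : ℝ) = 2 ^ 2 := by norm_num
      _ ≤ 2 ^ n := pow_le_pow_right₀ (by norm_num) hn
  -- Here `ε ≤ 2⁻ⁿ ≤ 1/4`, which rules out an empty circuit.
  have hLB : 0 < LB := by
    rcases Nat.eq_zero_or_pos LB with rfl | hLB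
    · have h1 := half_le_of_isApproxTwoDesign_of_isEmpty hn μB hB
      have h2 : (1 : ℝ) / 2 ^ n ≤ 1 / 4 := by gcongr
      linarith
    · exact hLB
  have e4 : (4 : ℝ) ^ n = 2 ^ n * 2 ^ n := by rw [← mul_pow]; norm_num
  have h5 : (2 : ℝ) / 4 ^ n ≤ 2 / 2 ^ n := by
    gcongr
    norm_num
  calc _ ≤ _ := variance_le_of_isApproxTwoDesign hLB hA hB h k
    _ ≤ (Real.exp 3 * (n : ℝ) ^ k) ^ 2 * (1 / 2 ^ n * ((2 / 2 ^ n + 1 / 2 ^ n) *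
        (2 / 4 ^ n + 1 / 2 ^ n / 2 ^ n))) := by
      gcongr
      exact card_lowLabels_le n k
    _ = _ := by
      have : (2 : ℝ) ^ (3 * n) = 2 ^ n * (2 ^ n * 2 ^ n) := by
        rw [pow_mul, ← mul_pow, ← mul_pow]; norm_num
      rw [this, e4]
      field_simp
      ring

end Compose

end PauliProp

theorem mainTheorem9 :
    (∃ C : ℝ, 0 < C ∧
      ∀ (k n LA LB : ℕ) (ε : ℝ)
        (μA : Measure (Fin LA → PauliProp.QUnitary n))
        (μB : Measure (Fin LB → PauliProp.QUnitary n)),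
        IsProbabilityMeasure μA → IsProbabilityMeasure μB →
        PauliProp.IsApproxTwoDesign (μA.map PauliProp.circuitUnitary) ε →
        PauliProp.IsApproxTwoDesign (μB.map PauliProp.circuitUnitary) ε →
        PauliProp.HasOrthogonalPauliPaths (PauliProp.zeroProj n) (PauliProp.composeLaw μA μB) →
        variance
            (PauliProp.lowWeightEstimator k (PauliProp.zeroProj n) (PauliProp.zeroProj n))
            (PauliProp.composeLaw μA μB)
          ≤ C * ((n : ℝ) ^ (4 * k) / 2 ^ (5 * n)) + C * (ε * (n : ℝ) ^ k / 2 ^ n)) ∧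
    (∀ (k : ℕ) (LA LB : ℕ → ℕ) (ε : ℕ → ℝ)
        (μA : ∀ n : ℕ, Measure (Fin (LA n) → PauliProp.QUnitary n))
        (μB : ∀ n : ℕ, Measure (Fin (LB n) → PauliProp.QUnitary n)),
        (∀ᶠ n : ℕ in atTop,
          IsProbabilityMeasure (μA n) ∧ IsProbabilityMeasure (μB n) ∧
          PauliProp.IsApproxTwoDesign ((μA n).map PauliProp.circuitUnitary) (ε n) ∧
          PauliProp.IsApproxTwoDesign ((μB n).map PauliProp.circuitUnitary) (ε n) ∧
          PauliProp.HasOrthogonalPauliPaths (PauliProp.zeroProj n)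
            (PauliProp.composeLaw (μA n) (μB n)) ∧
          ε n ≤ 1 / (2 ^ n * (n : ℝ) ^ k)) →
        ((fun n : ℕ =>
            PauliProp.XQ (PauliProp.composeLaw (μA n) (μB n))
              (PauliProp.lowWeightEstimator k (PauliProp.zeroProj n) (PauliProp.zeroProj n)))
          =o[atTop] (fun n : ℕ => (1 : ℝ) / 2 ^ (3 * n))) ∧
        ¬ ((fun n : ℕ => (1 : ℝ) / 2 ^ (3 * n))
          =O[atTop] (fun n : ℕ =>
            PauliProp.XQ (PauliProp.composeLaw (μA n) (μB n))
              (PauliProp.lowWeightEstimator k (PauliProp.zeroProj n)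
                (PauliProp.zeroProj n))))) := by
  refine ⟨⟨32 * Real.exp 3 ^ 2, by positivity, fun k n LA LB ε μA μB _ _ hA hB h =>
    PauliProp.variance_le_exp hA hB h k⟩, fun k LA LB ε μA μB hev => ?_⟩
  have hbig : (fun n : ℕ => PauliProp.XQ (PauliProp.composeLaw (μA n) (μB n))
      (PauliProp.lowWeightEstimator k (PauliProp.zeroProj n) (PauliProp.zeroProj n)))
      =O[atTop] fun n : ℕ => (n : ℝ) ^ (2 * k) / 2 ^ n * (1 / 2 ^ (3 * n)) := by
    refine IsBigO.of_bound (9 * Real.exp 3 ^ 2) ?_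
    filter_upwards [hev, eventually_ge_atTop 2] with n ⟨_, _, hA, hB, h, hε⟩ hn
    rw [PauliProp.XQ_lowWeightEstimator h, Real.norm_of_nonneg (variance_nonneg _ _),
      Real.norm_of_nonneg (by positivity)]
    exact PauliProp.variance_le_of_small_error hn hε hA hB h
  have hsmall : (fun n : ℕ => (n : ℝ) ^ (2 * k) / 2 ^ n * (1 / 2 ^ (3 * n)))
      =o[atTop] fun n : ℕ => (1 : ℝ) / 2 ^ (3 * n) := by
    have h1 := (isLittleO_one_iff ℝ).mpr
      (tendsto_pow_const_div_const_pow_of_one_lt (2 * k) (one_lt_two : (1 : ℝ) < 2))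
    simpa only [one_mul] using
      h1.mul_isBigO (isBigO_refl (fun n : ℕ => (1 : ℝ) / 2 ^ (3 * n)) atTop)
  have hlittle := hbig.trans_isLittleO hsmall
  -- A lower bound of order `2^{-3n}` would make this nonvanishing sequence negligible against
  -- itself.
  exact ⟨hlittle, fun hO => isLittleO_irrefl
    (Frequently.of_forall fun n => by positivity) (hO.trans_isLittleO hlittle)⟩
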